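/- **Online local learning.** There are $n$ items and $L$ labels. In each round $t=1,\dots,T$ the learner is shown a pair of distinct items $(i_t,j_t)$, replies with a pair of labels $(a_t,b_t)\in[L]^2$, and is then shown the payoff function $P^t:[L]^2\to[-1,1]$ (with rational values) and receives the payoff $P^t(a_t,b_t)$. The sequence of pairs and payoff functions is fixed in advance but revealed round by round. The learner has regret at most $r$ on such a game if its expected total payoff, over its own randomness, is at least $\max_{\ell:[n]\to[L]}\sum_{t} P^t(\ell(i_t),\ell(j_t))-r$. **Planted clique.** $G(N,1/2)$ is the Erdős–Rényi random graph on $N$ vertices; $G(N,1/2,k)$ is a sample of $G(N,1/2)$ to which all edges inside a uniformly random set of $k$ vertices are added. Algorithms are randomized (fair coins) random access machines with addition and subtraction, and time is the number of steps. **Theorem 1.** Let $\varepsilon,\delta:\mathbb N\to\mathbb R$ be such that $\varepsilon(N)=\Omega(1)$ (i.e. $\varepsilon(N)\ge\varepsilon_0>0$ for all large $N$), $N^{1/2-\varepsilon(N)}\to\infty$ (automatic for a constant $\varepsilon<1/2$), and $\delta(N)=\omega(1/\log N)$ (i.e. $\delta(N)\log N\to\infty$). Put $$\beta(N)=\bigl(1-\delta(N)\bigr)\,\frac{1}{\frac12+\varepsilon(N)}-1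 .$$ Suppose that there are a constant $C$ and a learning algorithm, which is told $n$, $L$, $T$ and $N$ at the start, such that the algorithm always replies with valid labels and runs in time polynomial in $n$, $L$, $T$ (and the bit length of the payoffs) on every game and for all outcomes of its coin flips, and such that for all sufficiently large $N$ it has regret at most $C\sqrt{n\,L^{\beta(N)}\,T}$ on every game with $n,L,T\le N$. (An algorithm that does not use $N$ is a special case.) Then there is an algorithm which, given only a graph on $N$ vertices, always halts in time polynomial in $N$ and which, for all sufficiently large $N$, answers "random" with probability at least $4/5$ when the graph is a sample of $G(N,1/2)$ and answers "planted" with probability at least $4/5$ when it is a sample of $G\bigl(N,1/2,\lfloor N^{1/2-\varepsilon(N)}\rfloor\bigr)$; the probabilities are over the graph and the coin flips. -/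

import Mathlib

open Filter Topology MeasureTheory
open scoped ENNReal

/-! ## Randomized random access machines -/

namespace RAM

/-- Programs of a randomized random access machine with structured control flow. The memory has
registers `0, 1, 2, …` and arrays `0, 1, 2, …`; a program mentions only finitely many of them.
Every register and every array cell holds a natural number. Addition and truncated subtraction are
the only arithmetic operations; there is no multiplication, so in `t` steps numbers grow by at most
`t` bits, and step counts are polynomially related to those of probabilistic Turing machines. -/
inductive Cmd : Type
  /-- register `x` becomes the constant `c` -/
  | const (x c : ℕ)
  /-- register `x` becomes the sum of registers `y` and `z` -/
  | add (x y z : ℕ)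
  /-- register `x` becomes the truncated difference of registers `y` and `z` -/
  | sub (x y z : ℕ)
  /-- register `x` becomes the cell of array `a` whose address is in register `y` -/
  | load (x a y : ℕ)
  /-- the cell of array `a` whose address is in register `y` becomes the content of register `x` -/
  | store (a y x : ℕ)
  /-- array `a` is replaced by a fresh array all of whose cells are zero -/
  | clear (a : ℕ)
  /-- register `x` becomes the outcome of a fair coin flip, `0` or `1` -/
  | flip (x : ℕ)
  /-- sequential composition -/
  | seq (c d : Cmd)
  /-- run `c` if register `x` is nonzero, and `d` otherwise -/
  | ite (x : ℕ) (c d : Cmd)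
  /-- run `c` as long as register `x` is nonzero -/
  | loop (x : ℕ) (c : Cmd)

/-- The content of the memory. -/
@[ext] structure Store : Type where
  /-- the registers -/
  reg : ℕ → ℕ
  /-- the arrays: first argument the name of the array, second argument the address -/
  arr : ℕ → ℕ → ℕ

/-- Overwrite register `x` by `v`. -/
def Store.setReg (s : Store) (x v : ℕ) : Store :=
  { s with reg := Function.update s.reg x v }

/-- Overwrite the whole array `a` by `f`. -/
def Store.setArr (s : Store) (a : ℕ) (f : ℕ → ℕ) : Store :=
  { s with arr := Function.update s.arr a f }

/-- A configuration: the list of commands still to be executed, and the memory. -/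
abbrev Config : Type := List Cmd × Store

/-- One step of the machine; it has unit cost. A machine with no command left has halted. -/
noncomputable def step : Config → PMF Config
  | ([], s) => PMF.pure ([], s)
  | (.const x c :: K, s) => PMF.pure (K, s.setReg x c)
  | (.add x y z :: K, s) => PMF.pure (K, s.setReg x (s.reg y + s.reg z))
  | (.sub x y z :: K, s) => PMF.pure (K, s.setReg x (s.reg y - s.reg z))
  | (.load x a y :: K, s) => PMF.pure (K, s.setReg x (s.arr a (s.reg y)))
  | (.store a y x :: K, s) =>
      PMF.pure (K, s.setArr a (Function.update (s.arr a) (s.reg y) (s.reg x)))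
  | (.clear a :: K, s) => PMF.pure (K, s.setArr a fun _ => 0)
  | (.flip x :: K, s) => (PMF.uniformOfFintype Bool).map fun b => (K, s.setReg x b.toNat)
  | (.seq c d :: K, s) => PMF.pure (c :: d :: K, s)
  | (.ite x c d :: K, s) => PMF.pure ((if s.reg x = 0 then d else c) :: K, s)
  | (.loop x c :: K, s) => PMF.pure (if s.reg x = 0 then K else c :: .loop x c :: K, s)

/-- The law of the configuration after `t` steps. -/
noncomputable def steps : ℕ → Config → PMF Config
  | 0, κ => PMF.pure κ
  | t + 1, κ => (step κ).bind (steps t)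

/-- The law of the result of running `c` on the memory `s` for at most `B` steps: the final memory
if the machine has halted by then, and `none` if it has not. -/
noncomputable def Cmd.run (c : Cmd) (B : ℕ) (s : Store) : PMF (Option Store) :=
  (steps B ([c], s)).map fun κ => if κ.1.isEmpty then some κ.2 else none

end RAM

/-! ## Online local learning -/

namespace LocalLearning

open RAM

/-- One round of online local learning with `n` items and `L` labels: a pair of items and a payoff
function. Payoffs are rational, so that they can be given to a machine. -/
structure Round (n L : ℕ) : Type where
  /-- the first item -/
  fst : Fin n
  /-- the second item -/
  snd : Fin n
  /-- the two items are distinct -/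
  ne : fst ≠ snd
  /-- the payoff of each pair of labels -/
  payoff : Fin L → Fin L → ℚ
  /-- payoffs are in `[-1, 1]` -/
  abs_payoff_le : ∀ a b, |payoff a b| ≤ 1

/-- All payoffs of the round are fractions of `b`-bit integers. -/
def Round.HasBits {n L : ℕ} (r : Round n L) (b : ℕ) : Prop :=
  ∀ x y, (r.payoff x y).num.natAbs < 2 ^ b ∧ (r.payoff x y).den < 2 ^ b

/-- The total payoff of the best fixed labeling of the items. -/
noncomputable def opt {n L : ℕ} (g : List (Round n L)) : ℝ :=
  ⨆ l : Fin n → Fin L, (g.map fun r => (r.payoff (l r.fst) (l r.snd) : ℝ)).sum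

/-- A learning algorithm: a machine that keeps its memory during the whole game and is called once
at the beginning (`start`), and in each round once to predict the two labels (`predict`) and once
after the payoff function has been revealed (`update`). -/
structure Learner : Type where
  /-- called once, before the first round -/
  start : Cmd
  /-- called when a pair of items is presented -/
  predict : Cmd
  /-- called when the payoff function of the round is revealed -/
  update : Cmd

/-- The memory at the beginning: the numbers of items, labels and rounds and the size parameter `N`
are in registers `0, 1, 2, 3`; everything else is zero. -/
def startStore (N n L T : ℕ) : Store where
  reg x := if x = 0 then n else if x = 1 then L else if x = 2 then T else if x = 3 then N else 0
  arr _ _ := 0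

/-- The two items of the round are written to registers `0` and `1`. -/
def showItems {n L : ℕ} (r : Round n L) (s : Store) : Store :=
  (s.setReg 0 r.fst).setReg 1 r.snd

/-- Write an `L × L` table row by row to the first `L * L` cells of array `a`. -/
def writeTable {L : ℕ} (a : ℕ) (f : Fin L → Fin L → ℕ) (s : Store) : Store :=
  s.setArr a fun i =>
    if h : i < L * L then
      f (finProdFinEquiv.symm ⟨i, h⟩).1 (finProdFinEquiv.symm ⟨i, h⟩).2
    else s.arr a i

/-- The payoff function of the round is written to arrays `0, 1, 2`: the numerators of the positive
parts, the numerators of the negative parts, and the denominators. -/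
def showPayoff {n L : ℕ} (r : Round n L) (s : Store) : Store :=
  writeTable 2 (fun a b => (r.payoff a b).den)
    (writeTable 1 (fun a b => (-(r.payoff a b).num).toNat)
      (writeTable 0 (fun a b => (r.payoff a b).num.toNat) s))

/-- The law of the total payoff of the learner in the rounds `g`, started from the memory `s`, where
each call may take at most `B` steps. The predicted labels are read from registers `0` and `1`. The
result is `none` if some call takes too long or if a reply is not a label. -/
noncomputable def Learner.play (A : Learner) (B : ℕ) {n L : ℕ} :
    List (Round n L) → Store → PMF (Option ℚ)
  | [], _ => PMF.pure (some 0)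
  | r :: g, s =>
    (A.predict.run B (showItems r s)).bind fun o =>
      match o with
      | none => PMF.pure none
      | some s₁ =>
        if h : s₁.reg 0 < L ∧ s₁.reg 1 < L then
          (A.update.run B (showPayoff r s₁)).bind fun o' =>
            match o' with
            | none => PMF.pure none
            | some s₂ =>
              (A.play B g s₂).map (Option.map (r.payoff ⟨s₁.reg 0, h.1⟩ ⟨s₁.reg 1, h.2⟩ + ·))
        else PMF.pure none

/-- The law of the total payoff of the learner in the whole game `g`. The game is fixed in advance,
but the learner sees it only round by round. -/
noncomputable def Learner.game (A : Learner) (B N : ℕ) {n L : ℕ} (g : List (Round n L)) :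
    PMF (Option ℚ) :=
  (A.start.run B (startStore N n L g.length)).bind fun o =>
    match o with
    | none => PMF.pure none
    | some s => A.play B g s

/-- The expected total payoff, over the coin flips of the learner. -/
noncomputable def Learner.expectedPayoff (A : Learner) (B N : ℕ) {n L : ℕ}
    (g : List (Round n L)) : ℝ :=
  ∑' o : Option ℚ, (A.game B N g o).toReal * ((o.getD 0 : ℚ) : ℝ)

/-- Regret at most `ρ N n L T` is achievable in time polynomial in the number `n` of items, the
number `L` of labels and the number `T` of rounds (and the bit length `b` of the payoffs).

The size parameter `N` is the parameter with respect to which the bound `ρ` is asymptotic. The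
learner may depend on it; the regret bound is required for all large `N` and all games whose
parameters `n`, `L`, `T` are at most `N`. The time bound is required for all games and all outcomes
of the coin flips. -/
def RegretAchievable (ρ : ℕ → ℕ → ℕ → ℕ → ℝ) : Prop :=
  ∃ (A : Learner) (p : Polynomial ℕ),
    (∀ (N n L b : ℕ) (g : List (Round n L)), 1 ≤ L → (∀ r ∈ g, r.HasBits b) →
      none ∉ (A.game (p.eval (n + L + g.length + b)) N g).support) ∧
    ∀ᶠ N : ℕ in atTop, ∀ (n L b : ℕ) (g : List (Round n L)),
      1 ≤ n → n ≤ N → 1 ≤ L → L ≤ N → g.length ≤ N → (∀ r ∈ g, r.HasBits b) →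
      opt g - ρ N n L g.length ≤ A.expectedPayoff (p.eval (n + L + g.length + b)) N g

end LocalLearning

/-! ## Planted clique -/

namespace PlantedClique

open RAM

/-- The number `1/2` as an edge probability. -/
noncomputable def half : unitInterval := ⟨1 / 2, by norm_num, by norm_num⟩

/-- The random graph `G(N, 1/2)`. -/
noncomputable def erdosRenyi (N : ℕ) : Measure (SimpleGraph (Fin N)) :=
  SimpleGraph.binomialRandom (Fin N) half

/-- The clique on the vertex set `S`. -/
def cliqueOn {N : ℕ} (S : Finset (Fin N)) : SimpleGraph (Fin N) :=
  SimpleGraph.fromRel fun u v => u ∈ S ∧ v ∈ S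

/-- The random graph `G(N, 1/2, k)`: a sample of `G(N, 1/2)` to which the clique on a uniformly
random set of `k` vertices is added. -/
noncomputable def planted (N k : ℕ) : Measure (SimpleGraph (Fin N)) :=
  ((N.choose k : ℝ≥0∞))⁻¹ • ∑ S ∈ (Finset.univ : Finset (Fin N)).powersetCard k,
    (erdosRenyi N).map fun G => G ⊔ cliqueOn S

open Classical in
/-- A graph as an input: the number of vertices is in register `0` and the adjacency matrix is,
row by row, in array `0`; everything else is zero. -/
noncomputable def graphStore {N : ℕ} (G : SimpleGraph (Fin N)) : Store where
  reg x := if x = 0 then N else 0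
  arr a i :=
    if h : a = 0 ∧ i < N * N then
      if G.Adj (finProdFinEquiv.symm ⟨i, h.2⟩).1 (finProdFinEquiv.symm ⟨i, h.2⟩).2 then 1 else 0
    else 0

/-- The probability, over the coin flips, that `D` halts within `B` steps on the input graph `G`
with output `v` in register `0`. -/
noncomputable def outputProb (D : Cmd) (B : ℕ) {N : ℕ} (G : SimpleGraph (Fin N)) (v : ℕ) : ℝ≥0∞ :=
  (D.run B (graphStore G)).map (Option.map fun s => s.reg 0) (some v)

/-- Some randomized algorithm, given only the graph, always halts in time polynomial in the number
`N` of vertices and, for all large `N`, answers `0` with probability at least `4/5` on a sample of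
`μ N` and `1` with probability at least `4/5` on a sample of `ν N`. -/
def PolyTimeDistinguishable (μ ν : (N : ℕ) → Measure (SimpleGraph (Fin N))) : Prop :=
  ∃ (D : Cmd) (q : Polynomial ℕ),
    (∀ (N : ℕ) (G : SimpleGraph (Fin N)), none ∉ (D.run (q.eval N) (graphStore G)).support) ∧
    ∀ᶠ N : ℕ in atTop,
      4 / 5 ≤ ∫⁻ G, outputProb D (q.eval N) G 0 ∂(μ N) ∧
      4 / 5 ≤ ∫⁻ G, outputProb D (q.eval N) G 1 ∂(ν N)

end PlantedClique

/-! The graph is turned into a game. Take `2m` disjoint blocks of `L = N / (2m)` vertices. The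
blocks are the items, the positions inside a block are the labels, and for all `i, j < m` there is
one round with items `i` and `m + j`, in which a pair of labels pays `1` if the two vertices are
adjacent and `-1` otherwise. The learner wins if it gets at least half of the maximal payoff `m²`.

On `G(N, 1/2)` the payoff tables live on disjoint sets of vertex pairs, so they are independent and
uniform (`sum_graphTable`). Whatever the learner replies, its payoff in each round is a fresh fair
sign. An exponential moment (`sum_expect_play_le`) and Markov's inequality (`sum_win_le`) bound the
probability of winning by `(9/10)^(m²)`.

On a planted graph, labeling each block by one of its clique vertices earns `m²` up to a loss from
the blocks that the clique misses (`le_opt_planted`). For `m = k / 20` a block contains at least `5`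
clique vertices on average, so few are missed (`eighty_mul_choose_le`). If the regret is at most `m²
/ 20`, the expected payoff is so close to `m²` that the learner wins with probability at least `4/5`
(`four_fifths_le_planted`). The regret bound is small enough by `regret_le`: squaring `C √(2m L^β
m²) ≤ m² / 20` gives `800 C² L^β ≤ m`. Here `mL` has order `N` and `L` is at most of order
`N^(1/2+ε)`, so for `δ ≤ 1` the power `L^(β+1)` is at most of order `N^(1-δ)`. The gap `N^δ` beats
every constant because `δ log N → ∞`.

The distinguisher is not told `k`, and `ε` need not be computable. Hence it plays the games for all
`m = 30, …, N + 29` that leave at least one vertex per block, and answers "planted" if any of them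
is won. The union bound over `m` costs at most `1/5` (`sum_pow_le`).

The machine is analysed through `wp`, the expectation of a function of the final memory over the
runs that halt in time. Only lower bounds on `wp` are needed for the distinguisher, and extra time
never lowers `wp`, so step counts only have to be bounded from above. Halting on all coin flips is
the lower bound `1` for the constant function `1`. The learner runs inside the distinguisher by
renaming its registers and arrays (`wp_call`), and `exists_distinguisher` collects everything about
machines that the probabilistic part uses. -/

namespace PMF

/-! ### Expectations of nonnegative functions -/

variable {α β : Type*}

/-- The expectation of a nonnegative function. -/
noncomputable def expect (p : PMF α) (g : α → ℝ≥0∞) : ℝ≥0∞ := ∑' x, p x * g x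

lemma expect_pure (a : α) (g : α → ℝ≥0∞) : (pure a).expect g = g a := by
  classical
  rw [expect, tsum_eq_single a]
  · simp
  · intro b hb
    simp [pure_apply, hb]

lemma expect_bind (p : PMF α) (q : α → PMF β) (g : β → ℝ≥0∞) :
    (p.bind q).expect g = p.expect fun a => (q a).expect g := by
  simp only [expect, bind_apply, ← ENNReal.tsum_mul_right, ← ENNReal.tsum_mul_left]
  rw [ENNReal.tsum_comm]
  simp only [mul_assoc]

lemma expect_map (p : PMF α) (h : α → β) (g : β → ℝ≥0∞) :
    (p.map h).expect g = p.expect fun a => g (h a) := by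
  rw [← bind_pure_comp, expect_bind]
  simp [expect_pure]

lemma expect_mono_support (p : PMF α) {g g' : α → ℝ≥0∞} (h : ∀ a ∈ p.support, g a ≤ g' a) :
    p.expect g ≤ p.expect g' := by
  refine ENNReal.tsum_le_tsum fun a => ?_
  by_cases ha : a ∈ p.support
  · gcongr; exact h a ha
  · rw [(p.apply_eq_zero_iff a).2 ha]; simp

lemma expect_mono (p : PMF α) {g g' : α → ℝ≥0∞} (h : ∀ a, g a ≤ g' a) :
    p.expect g ≤ p.expect g' := p.expect_mono_support fun a _ => h a

lemma expect_const (p : PMF α) (c : ℝ≥0∞) : (p.expect fun _ => c) = c := by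
  rw [expect, ENNReal.tsum_mul_right, p.tsum_coe, one_mul]

lemma expect_add (p : PMF α) (g g' : α → ℝ≥0∞) :
    (p.expect fun a => g a + g' a) = p.expect g + p.expect g' := by
  simp only [expect, mul_add, ENNReal.tsum_add]

lemma expect_const_mul (p : PMF α) (c : ℝ≥0∞) (g : α → ℝ≥0∞) :
    (p.expect fun a => c * g a) = c * p.expect g := by
  simp only [expect, ← ENNReal.tsum_mul_left]
  exact tsum_congr fun a => by ring

lemma expect_finset_sum {ι : Type*} (p : PMF α) (s : Finset ι) (g : ι → α → ℝ≥0∞) :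
    (p.expect fun a => ∑ i ∈ s, g i a) = ∑ i ∈ s, p.expect (g i) := by
  simp only [expect, Finset.mul_sum]
  exact Summable.tsum_finsetSum fun _ _ => ENNReal.summable

open Classical in
lemma apply_eq_expect (p : PMF α) (a : α) : p a = p.expect fun b => if b = a then 1 else 0 := by
  rw [expect, tsum_eq_single a]
  · simp
  · intro b hb; simp [hb]

/-- Mass at `a` would be lost, because `g` vanishes there and is at most `1` elsewhere. With `g` the
indicator of halting this turns an expectation bound into a statement on all outcomes of the coin
flips. -/
lemma notMem_support_of_one_le_expect (p : PMF α) {a : α} {g : α → ℝ≥0∞} (hg : ∀ b, g b ≤ 1)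
    (ha : g a = 0) (h : 1 ≤ p.expect g) : a ∉ p.support := by
  classical
  rw [← p.apply_eq_zero_iff]
  have h1 : p.expect g + p a ≤ 1 := by
    rw [p.apply_eq_expect a, ← expect_add]
    refine le_trans (p.expect_mono (g' := fun _ => 1) fun b => ?_) (p.expect_const 1).le
    by_cases hb : b = a
    · simp [hb, ha]
    · simpa [hb] using hg b
  have h2 : 1 + p a ≤ 1 + 0 := by
    rw [add_zero]; exact le_trans (by gcongr) h1
  simpa using (ENNReal.add_le_add_iff_left ENNReal.one_ne_top).1 h2

end PMF

namespace RAM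

/-! ### Expected final values -/

/-- The expectation of `f` at the final memory, counting only the runs that halt within the given
number of steps. -/
noncomputable def wp : ℕ → Config → (Store → ℝ≥0∞) → ℝ≥0∞
  | 0, κ, f => if κ.1.isEmpty then f κ.2 else 0
  | t + 1, κ, f => (step κ).expect fun κ' => wp t κ' f

lemma wp_nil (t : ℕ) (s : Store) (f : Store → ℝ≥0∞) : wp t ([], s) f = f s := by
  induction t with
  | zero => simp [wp]
  | succ t ih => simp [wp, step, PMF.expect_pure, ih]

lemma wp_le_wp_succ (t : ℕ) (κ : Config) (f : Store → ℝ≥0∞) : wp t κ f ≤ wp (t + 1) κ f := by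
  induction t generalizing κ with
  | zero =>
    obtain ⟨_ | ⟨c, K⟩, s⟩ := κ
    · simp [wp_nil]
    · simp [wp]
  | succ t ih => exact PMF.expect_mono _ fun κ' => ih κ'

lemma wp_mono_time {t t' : ℕ} (h : t ≤ t') (κ : Config) (f : Store → ℝ≥0∞) :
    wp t κ f ≤ wp t' κ f :=
  monotone_nat_of_le_succ (f := fun t => wp t κ f) (fun t => wp_le_wp_succ t κ f) h

lemma wp_eq_expect_steps (t : ℕ) (κ : Config) (f : Store → ℝ≥0∞) :
    wp t κ f = (steps t κ).expect fun κ' => if κ'.1.isEmpty then f κ'.2 else 0 := by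
  induction t generalizing κ with
  | zero => simp [wp, steps, PMF.expect_pure]
  | succ t ih => simp [wp, steps, PMF.expect_bind, ih]

lemma expect_run (c : Cmd) (B : ℕ) (s : Store) (f : Store → ℝ≥0∞) :
    ((c.run B s).expect fun o => o.elim 0 f) = wp B ([c], s) f := by
  rw [wp_eq_expect_steps, Cmd.run, PMF.expect_map]
  congr 1
  funext κ
  split_ifs <;> rfl

/-! ### Deterministic execution -/

/-- Within `τ` steps the machine gets from the configuration `κ` to the configuration `κ'`. -/
def Leads (κ κ' : Config) (τ : ℕ) : Prop := ∀ t f, wp t κ' f ≤ wp (t + τ) κ f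

lemma Leads.trans {κ κ' κ'' : Config} {τ τ' : ℕ} (h : Leads κ κ' τ) (h' : Leads κ' κ'' τ') :
    Leads κ κ'' (τ + τ') := fun t f => by
  rw [add_comm τ, ← add_assoc]; exact (h' t f).trans (h _ f)

lemma Leads.mono {κ κ' : Config} {τ τ' : ℕ} (h : Leads κ κ' τ) (hτ : τ ≤ τ') : Leads κ κ' τ' :=
  fun t f => (h t f).trans (wp_mono_time (by omega) _ _)

lemma leads_of_step {κ κ' : Config} (h : step κ = PMF.pure κ') : Leads κ κ' 1 := fun t f => by
  simp [wp, h, PMF.expect_pure]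

section Step
variable (K : List Cmd) (s : Store)

lemma leads_const (x c : ℕ) : Leads (.const x c :: K, s) (K, s.setReg x c) 1 := leads_of_step rfl
lemma leads_add (x y z : ℕ) :
    Leads (.add x y z :: K, s) (K, s.setReg x (s.reg y + s.reg z)) 1 := leads_of_step rfl
lemma leads_sub (x y z : ℕ) :
    Leads (.sub x y z :: K, s) (K, s.setReg x (s.reg y - s.reg z)) 1 := leads_of_step rfl
lemma leads_load (x a y : ℕ) :
    Leads (.load x a y :: K, s) (K, s.setReg x (s.arr a (s.reg y))) 1 := leads_of_step rfl
lemma leads_store (a y x : ℕ) :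
    Leads (.store a y x :: K, s)
      (K, s.setArr a (Function.update (s.arr a) (s.reg y) (s.reg x))) 1 := leads_of_step rfl
lemma leads_clear (a : ℕ) : Leads (.clear a :: K, s) (K, s.setArr a fun _ => 0) 1 :=
  leads_of_step rfl
lemma leads_seq (c d : Cmd) : Leads (.seq c d :: K, s) (c :: d :: K, s) 1 := leads_of_step rfl
lemma leads_ite_pos {x : ℕ} (c d : Cmd) (h : s.reg x ≠ 0) :
    Leads (.ite x c d :: K, s) (c :: K, s) 1 := leads_of_step (by simp [step, h])
lemma leads_ite_zero {x : ℕ} (c d : Cmd) (h : s.reg x = 0) :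
    Leads (.ite x c d :: K, s) (d :: K, s) 1 := leads_of_step (by simp [step, h])
lemma leads_loop_pos {x : ℕ} (c : Cmd) (h : s.reg x ≠ 0) :
    Leads (.loop x c :: K, s) (c :: .loop x c :: K, s) 1 := leads_of_step (by simp [step, h])
lemma leads_loop_zero {x : ℕ} (c : Cmd) (h : s.reg x = 0) :
    Leads (.loop x c :: K, s) (K, s) 1 := leads_of_step (by simp [step, h])

end Step

/-- A command that deterministically transforms the memory `s` into `s'` in at most `τ` steps. -/
def Exec (c : Cmd) (s s' : Store) (τ : ℕ) : Prop := ∀ K, Leads (c :: K, s) (K, s') τ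

lemma Exec.mono {c : Cmd} {s s' : Store} {τ τ' : ℕ} (h : Exec c s s' τ) (hτ : τ ≤ τ') :
    Exec c s s' τ' := fun K => (h K).mono hτ

lemma Exec.congr {c : Cmd} {s s' s'' : Store} {τ τ' : ℕ} (h : Exec c s s' τ) (hs : s' = s'')
    (hτ : τ ≤ τ') : Exec c s s'' τ' := hs ▸ h.mono hτ

lemma Exec.seq {c d : Cmd} {s s' s'' : Store} {τ τ' : ℕ} (h : Exec c s s' τ)
    (h' : Exec d s' s'' τ') : Exec (.seq c d) s s'' (τ + τ' + 1) := fun K =>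
  (((leads_seq K s c d).trans (h _)).trans (h' K)).mono (by omega)

/-- The family `F` is the loop invariant, indexed by the value of the counter, which runs down to
`0`. -/
lemma exec_loop {x : ℕ} {c : Cmd} {τ : ℕ} (F : ℕ → Store) (n : ℕ) (hF : ∀ i, (F i).reg x = i)
    (h : ∀ i < n, Exec c (F (i + 1)) (F i) τ) :
    Exec (.loop x c) (F n) (F 0) (n * (τ + 1) + 1) := by
  induction n with
  | zero => exact fun K => (leads_loop_zero K _ c (hF 0)).mono (by omega)
  | succ n ih =>
    intro K
    refine (((leads_loop_pos K (F (n + 1)) c (by simp [hF])).trans (h n (by omega) _)).trans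
      (ih (fun i hi => h i (by omega)) K)).mono ?_
    rw [Nat.succ_mul]; omega

/-! ### Expressions -/

@[simp] lemma setReg_reg (s : Store) (x v y : ℕ) :
    (s.setReg x v).reg y = if y = x then v else s.reg y := by
  simp [Store.setReg, Function.update_apply]

@[simp] lemma setReg_arr (s : Store) (x v : ℕ) : (s.setReg x v).arr = s.arr := rfl

@[simp] lemma setArr_reg (s : Store) (a : ℕ) (f : ℕ → ℕ) : (s.setArr a f).reg = s.reg := rfl

@[simp] lemma setArr_arr (s : Store) (a : ℕ) (f : ℕ → ℕ) (b : ℕ) :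
    (s.setArr a f).arr b = if b = a then f else s.arr b := by
  simp [Store.setArr, Function.update_apply]

lemma store_ext {s s' : Store} (h : ∀ x, s.reg x = s'.reg x) (h' : ∀ a, s.arr a = s'.arr a) :
    s = s' := Store.ext (funext h) (funext h')

/-- Arithmetic expressions. The first factor of a product is a register. -/
inductive Expr : Type
  | const (c : ℕ)
  | reg (x : ℕ)
  | add (a b : Expr)
  | sub (a b : Expr)
  | mul (x : ℕ) (b : Expr)
  | get (a : ℕ) (e : Expr)

namespace Expr

/-- The value of an expression. -/
@[simp] def eval : Expr → Store → ℕ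
  | const c, _ => c
  | reg x, s => s.reg x
  | add a b, s => a.eval s + b.eval s
  | sub a b, s => a.eval s - b.eval s
  | mul x b, s => s.reg x * b.eval s
  | get a e, s => s.arr a (e.eval s)

/-- All registers in the expression are below `S`. -/
@[simp] def Below (S : ℕ) : Expr → Prop
  | const _ => True
  | reg x => x < S
  | add a b => a.Below S ∧ b.Below S
  | sub a b => a.Below S ∧ b.Below S
  | mul x b => x < S ∧ b.Below S
  | get _ e => e.Below S

/-- The number of steps for the evaluation of an expression. -/
@[simp] def cost : Expr → Store → ℕ
  | const _, _ => 1
  | reg _, _ => 1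
  | add a b, s => a.cost s + b.cost s + 5
  | sub a b, s => a.cost s + b.cost s + 5
  | mul x b, s => b.cost s + 4 * s.reg x + 10
  | get _ e, s => e.cost s + 2

/-- A command that evaluates an expression into register `x`, using the registers above `x` as
scratch space. -/
def code : Expr → ℕ → Cmd
  | const c, x => .const x c
  | reg y, x => .add x y x
  | add a b, x => .seq (.seq (a.code x) (b.code (x + 1))) (.seq (.add x x (x + 1)) (.const (x + 1) 0))
  | sub a b, x => .seq (.seq (a.code x) (b.code (x + 1))) (.seq (.sub x x (x + 1)) (.const (x + 1) 0))
  | mul y b, x =>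
    .seq (.seq (b.code (x + 1)) (.seq (.add (x + 2) y x) (.const (x + 3) 1)))
      (.seq (.loop (x + 2) (.seq (.add x x (x + 1)) (.sub (x + 2) (x + 2) (x + 3))))
        (.seq (.const (x + 1) 0) (.const (x + 3) 0)))
  | get a e, x => .seq (e.code x) (.load x a x)

lemma eval_setReg {S : ℕ} {e : Expr} (he : e.Below S) {s : Store} {x : ℕ} (hx : S ≤ x) (v : ℕ) :
    e.eval (s.setReg x v) = e.eval s := by
  induction e with
  | const c => rfl
  | reg y =>
    have : y ≠ x := by simp at he; omega
    simp [this]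
  | add a b iha ihb => simp [iha he.1, ihb he.2]
  | sub a b iha ihb => simp [iha he.1, ihb he.2]
  | mul y b ihb =>
    have : y ≠ x := by simp at he; omega
    simp [this, ihb he.2]
  | get a e ihe => simp [ihe he]

lemma cost_setReg {S : ℕ} {e : Expr} (he : e.Below S) {s : Store} {x : ℕ} (hx : S ≤ x) (v : ℕ) :
    e.cost (s.setReg x v) = e.cost s := by
  induction e with
  | const c => rfl
  | reg y => rfl
  | add a b iha ihb => simp [iha he.1, ihb he.2]
  | sub a b iha ihb => simp [iha he.1, ihb he.2]
  | mul y b ihb =>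
    have : y ≠ x := by simp at he; omega
    simp [this, ihb he.2]
  | get a e ihe => simp [ihe he]

/-- All scratch registers are zero on entry, and all but the target `x` are zeroed again on exit.
This makes evaluations composable, and it lets a register be copied by adding a zero register to it.
-/
lemma exec_code {S : ℕ} {e : Expr} (he : e.Below S) {s : Store} {x : ℕ} (hx : S ≤ x)
    (hs : ∀ z, x ≤ z → s.reg z = 0) : Exec (e.code x) s (s.setReg x (e.eval s)) (e.cost s) := by
  induction e generalizing s x with
  | const c => exact fun K => leads_const K s x c
  | reg y =>
    intro K
    have := leads_add K s x y x
    rwa [hs x le_rfl] at this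
  | add a b iha ihb =>
    have h1 := iha he.1 hx hs
    have h2 := ihb he.2 (s := s.setReg x (a.eval s)) (x := x + 1) (by omega)
      (fun z hz => by rw [setReg_reg, if_neg (by omega), hs z (by omega)])
    rw [eval_setReg he.2 hx, cost_setReg he.2 hx] at h2
    have h3 := (h1.seq h2).seq (Exec.seq (fun K => leads_add K _ x x (x + 1))
      (fun K => leads_const K _ (x + 1) 0))
    refine h3.congr (store_ext (fun z => ?_) fun _ => rfl) (by simp only [cost]; omega)
    have := hs (x + 1) (by omega)
    by_cases hz1 : z = x + 1
    · simp [hz1, this]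
    by_cases hz : z = x <;> simp [hz, hz1]
  | sub a b iha ihb =>
    have h1 := iha he.1 hx hs
    have h2 := ihb he.2 (s := s.setReg x (a.eval s)) (x := x + 1) (by omega)
      (fun z hz => by rw [setReg_reg, if_neg (by omega), hs z (by omega)])
    rw [eval_setReg he.2 hx, cost_setReg he.2 hx] at h2
    have h3 := (h1.seq h2).seq (Exec.seq (fun K => leads_sub K _ x x (x + 1))
      (fun K => leads_const K _ (x + 1) 0))
    refine h3.congr (store_ext (fun z => ?_) fun _ => rfl) (by simp only [cost]; omega)
    have := hs (x + 1) (by omega)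
    by_cases hz1 : z = x + 1
    · simp [hz1, this]
    by_cases hz : z = x <;> simp [hz, hz1]
  | mul y b ihb =>
    have h1 := ihb he.2 (s := s) (x := x + 1) (by omega) (fun z hz => hs z (by omega))
    have hy : y < x := lt_of_lt_of_le he.1 hx
    set w := b.eval s with hw
    -- Multiplication is repeated addition: with `i` additions left, register `x` holds the product
    -- for the `s.reg y - i` additions done. Register `x + 3` holds the constant `1` for the
    -- decrement.
    let F : ℕ → Store := fun i =>
      (((s.setReg (x + 1) w).setReg (x + 3) 1).setReg (x + 2) i).setReg x ((s.reg y - i) * w)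
    have hloop := exec_loop (x := x + 2) (τ := 3)
      (c := .seq (.add x x (x + 1)) (.sub (x + 2) (x + 2) (x + 3))) F (s.reg y)
      (fun i => by simp [F]) (fun i hi => by
        refine Exec.mono ?_ (le_refl _)
        convert Exec.seq (fun K => leads_add K (F (i + 1)) x x (x + 1))
          (fun K => leads_sub K _ (x + 2) (x + 2) (x + 3)) using 1
        refine store_ext (fun z => ?_) fun _ => rfl
        have h4 : (s.reg y - i) * w = (s.reg y - (i + 1)) * w + w := by
          rw [← Nat.succ_mul]; congr 1; omega
        clear hs h1 ihb
        by_cases hz : z = x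
        · simp [F, hz, h4]
        by_cases hz2 : z = x + 2 <;> simp [F, hz, hz2])
    have h2 : Exec (.seq (.add (x + 2) y x) (.const (x + 3) 1)) (s.setReg (x + 1) w)
        (F (s.reg y)) 3 := by
      convert Exec.seq (fun K => leads_add K (s.setReg (x + 1) w) (x + 2) y x)
        (fun K => leads_const K _ (x + 3) 1) using 1
      refine store_ext (fun z => ?_) fun _ => rfl
      have h0 := hs x le_rfl
      have h5 : y ≠ x + 1 := by omega
      by_cases hz : z = x
      · simp [F, hz, h0]
      by_cases hz2 : z = x + 2
      · simp [F, hz2, h5, h0]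
      simp [F, hz, hz2]
    have h3 := (h1.seq h2).seq (hloop.seq (Exec.seq (fun K => leads_const K _ (x + 1) 0)
      (fun K => leads_const K _ (x + 3) 0)))
    refine h3.congr (store_ext (fun z => ?_) fun _ => rfl) (by simp only [cost]; omega)
    have h0 := hs x le_rfl
    have h11 := hs (x + 1) (by omega)
    have h12 := hs (x + 2) (by omega)
    have h13 := hs (x + 3) (by omega)
    simp only [setReg_reg, eval, F]
    split_ifs <;> simp_all
  | get a e ihe =>
    have h3 := (ihe he hx hs).seq (fun K => leads_load K _ x a x)
    refine h3.congr (store_ext (fun z => ?_) fun _ => rfl) (by simp only [cost]; omega)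
    simp only [setReg_reg, eval]
    split_ifs <;> simp_all

end Expr

/-- Register `r` becomes the value of `e`; the registers from `S` on are scratch space. -/
def assign (S r : ℕ) (e : Expr) : Cmd :=
  .seq (e.code S) (.seq (.add r S (S + 1)) (.const S 0))

lemma exec_assign {S r : ℕ} {e : Expr} (he : e.Below S) {s : Store} (hr : r < S)
    (hs : ∀ z, S ≤ z → s.reg z = 0) :
    Exec (assign S r e) s (s.setReg r (e.eval s)) (e.cost s + 4) := by
  refine ((Expr.exec_code he le_rfl hs).seq (Exec.seq (fun K => leads_add K _ r S (S + 1))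
    (fun K => leads_const K _ S 0))).congr (store_ext (fun z => ?_) fun _ => rfl) (by omega)
  have h1 := hs S le_rfl
  have h2 := hs (S + 1) (by omega)
  simp only [setReg_reg]
  split_ifs <;> first | omega | simp_all

/-- The cell of array `a` with address `e` becomes the value of `e'`. -/
def put (S a : ℕ) (e e' : Expr) : Cmd :=
  .seq (.seq (e.code S) (e'.code (S + 1)))
    (.seq (.store a S (S + 1)) (.seq (.const S 0) (.const (S + 1) 0)))

lemma exec_put {S a : ℕ} {e e' : Expr} (he : e.Below S) (he' : e'.Below S) {s : Store}
    (hs : ∀ z, S ≤ z → s.reg z = 0) :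
    Exec (put S a e e') s (s.setArr a (Function.update (s.arr a) (e.eval s) (e'.eval s)))
      (e.cost s + e'.cost s + 7) := by
  have h1 := Expr.exec_code he le_rfl hs
  have h2 := Expr.exec_code he' (s := s.setReg S (e.eval s)) (x := S + 1) (by omega)
      (fun z hz => by rw [setReg_reg, if_neg (by omega), hs z (by omega)])
  rw [Expr.eval_setReg he' le_rfl, Expr.cost_setReg he' le_rfl] at h2
  have h3 := (h1.seq h2).seq (Exec.seq (fun K => leads_store K _ a S (S + 1))
    (Exec.seq (fun K => leads_const K _ S 0) (fun K => leads_const K _ (S + 1) 0)))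
  have h1 := hs S le_rfl
  have h2 := hs (S + 1) (by omega)
  refine h3.congr (store_ext (fun z => ?_) fun b => ?_) (by omega)
  · simp only [setReg_reg, setArr_reg]
    split_ifs <;> first | omega | simp_all
  · simp

/-- Run `c` for each value `w - 1, …, 0` of register `x`, where `w` is the value of `e`. -/
def countdown (S x : ℕ) (e : Expr) (c : Cmd) : Cmd :=
  .seq (assign S x e) (.loop x (.seq (assign S x (.sub (.reg x) (.const 1))) c))

/-- The counter is decremented before the body runs, so the body that leads from `F (i + 1)` to `F
i` sees the index `i`, and the indices seen are exactly those below the value of `e`. -/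
lemma exec_countdown {S x : ℕ} {e : Expr} {c : Cmd} {τ : ℕ} {s : Store} (F : ℕ → Store)
    (he : e.Below S) (hx : x < S) (hS : ∀ i z, S ≤ z → (F i).reg z = 0)
    (hs : ∀ z, S ≤ z → s.reg z = 0)
    (hF : ∀ i, (F i).reg x = i) (h0 : s.setReg x (e.eval s) = F (e.eval s))
    (h : ∀ i < e.eval s, Exec c ((F (i + 1)).setReg x i) (F i) τ) :
    Exec (countdown S x e c) s (F 0) (e.eval s * (τ + 13) + e.cost s + 6) := by
  have h1 := exec_assign (r := x) he hx hs
  rw [h0] at h1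
  refine Exec.mono (h1.seq (exec_loop (x := x) (τ := τ + 12) F (e.eval s) hF fun i hi => ?_))
    (by rw [add_assoc τ 12 1]; omega)
  have h2 := exec_assign (S := S) (r := x) (e := .sub (.reg x) (.const 1)) (s := F (i + 1))
    (by simp [hx]) hx (hS _)
  refine (h2.seq (s'' := F i) (τ' := τ) ?_).mono (by simp; omega)
  convert h i hi using 2
  simp [hF]

/-! ### Running a machine inside another one -/

namespace Cmd

/-- All registers and arrays in the command are below `M`. -/
def Below (M : ℕ) : Cmd → Prop
  | .const x _ => x < M
  | .add x y z => x < M ∧ y < M ∧ z < M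
  | .sub x y z => x < M ∧ y < M ∧ z < M
  | .load x a y => x < M ∧ a < M ∧ y < M
  | .store a y x => a < M ∧ y < M ∧ x < M
  | .clear a => a < M
  | .flip x => x < M
  | .seq c d => c.Below M ∧ d.Below M
  | .ite x c d => x < M ∧ c.Below M ∧ d.Below M
  | .loop x c => x < M ∧ c.Below M

lemma Below.mono {M M' : ℕ} (h : M ≤ M') {c : Cmd} (hc : c.Below M) : c.Below M' := by
  induction c with
  | seq c d ihc ihd => exact ⟨ihc hc.1, ihd hc.2⟩
  | ite x c d ihc ihd => exact ⟨hc.1.trans_le h, ihc hc.2.1, ihd hc.2.2⟩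
  | loop x c ihc => exact ⟨hc.1.trans_le h, ihc hc.2⟩
  | _ => simp only [Below] at hc ⊢; omega

lemma exists_below (c : Cmd) : ∃ M, c.Below M := by
  induction c with
  | const x c => exact ⟨x + 1, by simp [Below]⟩
  | add x y z => exact ⟨x + y + z + 1, by simp only [Below]; omega⟩
  | sub x y z => exact ⟨x + y + z + 1, by simp only [Below]; omega⟩
  | load x y z => exact ⟨x + y + z + 1, by simp only [Below]; omega⟩
  | store x y z => exact ⟨x + y + z + 1, by simp only [Below]; omega⟩
  | clear a => exact ⟨a + 1, by simp [Below]⟩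
  | flip a => exact ⟨a + 1, by simp [Below]⟩
  | seq c d ihc ihd =>
    obtain ⟨M, hM⟩ := ihc
    obtain ⟨M', hM'⟩ := ihd
    exact ⟨M + M', hM.mono (by omega), hM'.mono (by omega)⟩
  | ite x c d ihc ihd =>
    obtain ⟨M, hM⟩ := ihc
    obtain ⟨M', hM'⟩ := ihd
    exact ⟨x + 1 + M + M', by omega, hM.mono (by omega), hM'.mono (by omega)⟩
  | loop x c ihc =>
    obtain ⟨M, hM⟩ := ihc
    exact ⟨x + 1 + M, by omega, hM.mono (by omega)⟩

/-- Rename the registers and arrays of a command. -/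
def shift (P : ℕ) : Cmd → Cmd
  | .const x c => .const (x + P) c
  | .add x y z => .add (x + P) (y + P) (z + P)
  | .sub x y z => .sub (x + P) (y + P) (z + P)
  | .load x a y => .load (x + P) (a + 1) (y + P)
  | .store a y x => .store (a + 1) (y + P) (x + P)
  | .clear a => .clear (a + 1)
  | .flip x => .flip (x + P)
  | .seq c d => .seq (c.shift P) (d.shift P)
  | .ite x c d => .ite (x + P) (c.shift P) (d.shift P)
  | .loop x c => .loop (x + P) (c.shift P)

end Cmd

/-- The memory of a machine that simulates another machine: the registers below `P` and array `0`
are its own, and behind them there are the first `M` registers and arrays of the simulated machine;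
everything else is zero. -/
def embed (P M : ℕ) (v G : ℕ → ℕ) (lo : Store) : Store where
  reg x := if x < P then v x else if x < P + M then lo.reg (x - P) else 0
  arr a := if a = 0 then G else if a < M + 1 then lo.arr (a - 1) else fun _ => 0

section Embed
variable {P M : ℕ} (v G : ℕ → ℕ) (lo : Store)

lemma embed_reg {x : ℕ} (hx : x < M) : (embed P M v G lo).reg (x + P) = lo.reg x := by
  simp only [embed]; rw [if_neg (by omega), if_pos (by omega)]; congr 1; omega

lemma embed_reg_ge {x : ℕ} (hx : P + M ≤ x) : (embed P M v G lo).reg x = 0 := by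
  simp only [embed]; rw [if_neg (by omega), if_neg (by omega)]

lemma embed_arr {a : ℕ} (ha : a < M) : (embed P M v G lo).arr (a + 1) = lo.arr a := by
  simp [embed, ha]

lemma embed_setReg {x : ℕ} (hx : x < M) (c : ℕ) :
    (embed P M v G lo).setReg (x + P) c = embed P M v G (lo.setReg x c) := by
  refine store_ext (fun z => ?_) fun _ => rfl
  simp only [embed, setReg_reg]
  split_ifs <;> first | rfl | omega

lemma embed_setReg_lt {x : ℕ} (hx : x < P) (c : ℕ) :
    (embed P M v G lo).setReg x c = embed P M (Function.update v x c) G lo := by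
  refine store_ext (fun z => ?_) fun _ => rfl
  simp only [embed, setReg_reg, Function.update_apply]
  split_ifs <;> first | rfl | omega

lemma embed_setArr {a : ℕ} (ha : a < M) (f : ℕ → ℕ) :
    (embed P M v G lo).setArr (a + 1) f = embed P M v G (lo.setArr a f) := by
  refine store_ext (fun z => rfl) fun b => ?_
  simp only [embed, setArr_arr]
  split_ifs <;> first | rfl | omega

/-- The renamed program moves in lockstep with the original one, on a memory that stays of the form
`embed`. Runs that exceed `B` steps count as `0` on the left, and the time saved by shorter runs is
passed on to `K`; hence an inequality. -/
lemma wp_call (t : ℕ) (K : List Cmd) (f : Store → ℝ≥0∞) (B : ℕ) (K' : List Cmd)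
    (hK : ∀ c ∈ K', c.Below M) :
    wp B (K', lo) (fun lo' => wp t (K, embed P M v G lo') f) ≤
      wp (t + B) (K'.map (Cmd.shift P) ++ K, embed P M v G lo) f := by
  induction B generalizing K' lo with
  | zero =>
    cases K' with
    | nil => simp [wp]
    | cons c K' => simp [wp]
  | succ B ih =>
    cases K' with
    | nil => rw [wp_nil]; exact wp_mono_time (by omega) _ _
    | cons c K' =>
      have hc := hK c (by simp)
      have hK' : ∀ c ∈ K', c.Below M := fun c hc => hK c (by simp [hc])
      rw [← add_assoc]
      cases c with
      | const x c =>
        simpa [wp, step, PMF.expect_pure, Cmd.shift, embed_setReg _ _ _ hc] using ih _ _ hK'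
      | add x y z =>
        obtain ⟨h1, h2, h3⟩ := hc
        simpa [wp, step, PMF.expect_pure, Cmd.shift, embed_setReg, embed_reg, h1, h2, h3]
          using ih _ _ hK'
      | sub x y z =>
        obtain ⟨h1, h2, h3⟩ := hc
        simpa [wp, step, PMF.expect_pure, Cmd.shift, embed_setReg, embed_reg, h1, h2, h3]
          using ih _ _ hK'
      | load x y z =>
        obtain ⟨h1, h2, h3⟩ := hc
        simpa [wp, step, PMF.expect_pure, Cmd.shift, embed_setReg, embed_reg, embed_arr, h1, h2,
          h3] using ih _ _ hK'
      | store x y z =>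
        obtain ⟨h1, h2, h3⟩ := hc
        simpa [wp, step, PMF.expect_pure, Cmd.shift, embed_setArr, embed_reg, embed_arr, h1, h2,
          h3] using ih _ _ hK'
      | clear x =>
        simpa [wp, step, PMF.expect_pure, Cmd.shift, embed_setArr _ _ _ hc] using ih _ _ hK'
      | flip x =>
        simp only [wp, step, PMF.expect_map, List.map_cons, List.cons_append, Cmd.shift,
          embed_setReg _ _ _ hc]
        exact PMF.expect_mono _ fun b => ih _ _ hK'
      | seq c d =>
        simpa [wp, step, PMF.expect_pure, Cmd.shift] using ih lo (c :: d :: K')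
          (by simpa using ⟨hc.1, hc.2, hK'⟩)
      | ite x c d =>
        have h := ih lo ((if lo.reg x = 0 then d else c) :: K')
          (by split_ifs <;> simpa using ⟨by simp [hc.2], hK'⟩)
        simp only [wp, step, PMF.expect_pure, Cmd.shift, List.map_cons, List.cons_append,
          embed_reg _ _ _ hc.1] at h ⊢
        split_ifs at h ⊢ <;> exact h
      | loop x c =>
        have h := ih lo (if lo.reg x = 0 then K' else c :: .loop x c :: K')
          (by
            split_ifs
            · exact hK'
            · simpa using ⟨hc.2, hc, hK'⟩)
        simp only [wp, step, PMF.expect_pure, Cmd.shift, List.map_cons, List.cons_append,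
          embed_reg _ _ _ hc.1] at h ⊢
        split_ifs at h ⊢ <;> exact h

end Embed

end RAM

namespace LocalLearning

open RAM

/-! ### The games -/

/-- The payoff of an edge is `1`, the payoff of a non-edge is `-1`. -/
def edgePayoff (e : Bool) : ℚ := if e then 1 else -1

/-- The round with items `i` and `m + j` in which the payoffs are given by a Boolean table. -/
def crossRound {m L : ℕ} (q : Fin m × Fin m) (t : Fin L → Fin L → Bool) : Round (m + m) L where
  fst := Fin.castAdd m q.1
  snd := Fin.natAdd m q.2
  ne h := by
    have := congrArg Fin.val h
    simp at this
    omega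
  payoff a b := edgePayoff (t a b)
  abs_payoff_le a b := by cases h : t a b <;> simp [edgePayoff]

lemma crossRound_hasBits {m L : ℕ} (q : Fin m × Fin m) (t : Fin L → Fin L → Bool) :
    (crossRound q t).HasBits 1 := by
  intro a b
  cases h : t a b <;> simp [crossRound, edgePayoff, h]

/-- The cells `(i, j - 1), …, (i, 0)`. -/
def rowCells {m : ℕ} (i : Fin m) : (j : ℕ) → j ≤ m → List (Fin m × Fin m)
  | 0, _ => []
  | j + 1, h => (i, ⟨j, h⟩) :: rowCells i j (Nat.le_of_succ_le h)

/-- The cells in the rows `i - 1, …, 0` of the `m × m` square. -/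
def cells {m : ℕ} : (i : ℕ) → i ≤ m → List (Fin m × Fin m)
  | 0, _ => []
  | i + 1, h => rowCells ⟨i, h⟩ m le_rfl ++ cells i (Nat.le_of_succ_le h)

lemma mem_rowCells {m : ℕ} {i : Fin m} {j : ℕ} {h : j ≤ m} {q : Fin m × Fin m} :
    q ∈ rowCells i j h ↔ q.1 = i ∧ q.2.val < j := by
  induction j with
  | zero => simp [rowCells]
  | succ j ih =>
    rw [rowCells, List.mem_cons, ih, Prod.ext_iff, Fin.ext_iff (a := q.2)]
    constructor
    · rintro (⟨h1, h2⟩ | ⟨h1, h2⟩)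
      · exact ⟨h1, by simp at h2; omega⟩
      · exact ⟨h1, by omega⟩
    · rintro ⟨h1, h2⟩
      by_cases h3 : q.2.val = j
      · exact Or.inl ⟨h1, h3⟩
      · exact Or.inr ⟨h1, by omega⟩

lemma mem_cells {m : ℕ} {i : ℕ} {h : i ≤ m} {q : Fin m × Fin m} :
    q ∈ cells i h ↔ q.1.val < i := by
  induction i with
  | zero => simp [cells]
  | succ i ih =>
    rw [cells, List.mem_append, ih, mem_rowCells, Fin.ext_iff]
    have := q.2.isLt
    simp only [this, and_true]
    omega

lemma nodup_rowCells {m : ℕ} {i : Fin m} {j : ℕ} {h : j ≤ m} : (rowCells i j h).Nodup := by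
  induction j with
  | zero => simp [rowCells]
  | succ j ih =>
    rw [rowCells, List.nodup_cons]
    exact ⟨fun h => by simpa using (mem_rowCells.1 h).2, ih⟩

/-- Every pair of blocks is played only once. For random tables, this makes the table of a round
independent of all that the learner has seen before. -/
lemma nodup_cells {m : ℕ} {i : ℕ} {h : i ≤ m} : (cells i h).Nodup := by
  induction i with
  | zero => simp [cells]
  | succ i ih =>
    rw [cells, List.nodup_append]
    refine ⟨nodup_rowCells, ih, fun a ha b hb hab => ?_⟩
    have h1 := (mem_rowCells.1 ha).1
    have h2 := mem_cells.1 hb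
    rw [← hab, h1] at h2
    simp at h2

lemma length_rowCells {m : ℕ} {i : Fin m} {j : ℕ} {h : j ≤ m} :
    (rowCells i j h).length = j := by
  induction j with
  | zero => rfl
  | succ j ih => rw [rowCells, List.length_cons, ih]

lemma length_cells {m : ℕ} {i : ℕ} {h : i ≤ m} : (cells i h).length = i * m := by
  induction i with
  | zero => simp [cells]
  | succ i ih => rw [cells, List.length_append, ih, length_rowCells, Nat.succ_mul, add_comm]

/-- The rounds with the given cells. -/
def roundsOf {m L : ℕ} (F : Fin m × Fin m → Fin L → Fin L → Bool) (l : List (Fin m × Fin m)) :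
    List (Round (m + m) L) := l.map fun q => crossRound q (F q)

/-- The game with `m + m` items and `m * m` rounds. -/
def crossGame {m L : ℕ} (F : Fin m × Fin m → Fin L → Fin L → Bool) : List (Round (m + m) L) :=
  roundsOf F (cells m le_rfl)

lemma length_crossGame {m L : ℕ} (F : Fin m × Fin m → Fin L → Fin L → Bool) :
    (crossGame F).length = m * m := by simp [crossGame, roundsOf, length_cells]

/-! ### Expected payoffs -/

lemma expect_play_nil (A : Learner) (B n L : ℕ) (s : Store) (Ψ : Option ℚ → ℝ≥0∞) :
    (A.play B ([] : List (Round n L)) s).expect Ψ = Ψ (some 0) := by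
  rw [Learner.play, PMF.expect_pure]

/-- The condition on `Ψ none` matches the convention of `wp`: calls that take too long, like invalid
replies, contribute nothing. -/
lemma expect_play_cons (A : Learner) (B : ℕ) {n L : ℕ} (r : Round n L) (g : List (Round n L))
    (s : Store) (Ψ : Option ℚ → ℝ≥0∞) (hΨ : Ψ none = 0) :
    (A.play B (r :: g) s).expect Ψ = wp B ([A.predict], showItems r s) fun s₁ =>
      if h : s₁.reg 0 < L ∧ s₁.reg 1 < L then
        wp B ([A.update], showPayoff r s₁) fun s₂ => (A.play B g s₂).expect fun o =>
          Ψ (o.map (r.payoff ⟨s₁.reg 0, h.1⟩ ⟨s₁.reg 1, h.2⟩ + ·))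
      else 0 := by
  rw [Learner.play, PMF.expect_bind, ← expect_run]
  congr 1
  funext o
  rcases o with _ | s₁
  · simp [PMF.expect_pure, hΨ]
  simp only [Option.elim_some]
  split_ifs with h
  · rw [PMF.expect_bind, ← expect_run]
    congr 1
    funext o
    rcases o with _ | s₂
    · simp [PMF.expect_pure, hΨ]
    · simp [PMF.expect_map]
  · simp [PMF.expect_pure, hΨ]

lemma expect_game (A : Learner) (B N : ℕ) {n L : ℕ} (g : List (Round n L))
    (Ψ : Option ℚ → ℝ≥0∞) (hΨ : Ψ none = 0) :
    (A.game B N g).expect Ψ = wp B ([A.start], startStore N n L g.length) fun s =>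
      (A.play B g s).expect Ψ := by
  rw [Learner.game, PMF.expect_bind, ← expect_run]
  congr 1
  funext o
  rcases o with _ | s
  · simp [PMF.expect_pure, hΨ]
  · rfl

end LocalLearning

namespace RAM

open LocalLearning

/-! ### The variables of the reduction -/

/-- The variables of the reduction. -/
structure Vars : Type where
  N : ℕ
  flag : ℕ
  c : ℕ
  m : ℕ
  L : ℕ
  d : ℕ
  neg : ℕ
  i : ℕ
  j : ℕ
  x : ℕ
  y : ℕ

/-- The registers in which the variables are kept. -/
def Vars.toReg (v : Vars) : ℕ → ℕ
  | 0 => v.N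
  | 1 => v.flag
  | 2 => v.c
  | 3 => v.m
  | 4 => v.L
  | 5 => v.d
  | 6 => v.neg
  | 7 => v.i
  | 8 => v.j
  | 9 => v.x
  | 10 => v.y
  | _ => 0

/-- The memory of the reduction: variables, the adjacency matrix and the memory of the learner. -/
def mem (M : ℕ) (G : ℕ → ℕ) (v : Vars) (lo : Store) : Store := embed 11 M v.toReg G lo

section Mem
variable (M : ℕ) (G : ℕ → ℕ) (v : Vars) (lo : Store)

lemma mem_clean : ∀ z, 11 + M ≤ z → (mem M G v lo).reg z = 0 := fun _ hz => embed_reg_ge _ _ _ hz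

@[simp] lemma mem_reg0 : (mem M G v lo).reg 0 = v.N := rfl
@[simp] lemma mem_reg1 : (mem M G v lo).reg 1 = v.flag := rfl
@[simp] lemma mem_reg2 : (mem M G v lo).reg 2 = v.c := rfl
@[simp] lemma mem_reg3 : (mem M G v lo).reg 3 = v.m := rfl
@[simp] lemma mem_reg4 : (mem M G v lo).reg 4 = v.L := rfl
@[simp] lemma mem_reg5 : (mem M G v lo).reg 5 = v.d := rfl
@[simp] lemma mem_reg6 : (mem M G v lo).reg 6 = v.neg := rfl
@[simp] lemma mem_reg7 : (mem M G v lo).reg 7 = v.i := rfl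
@[simp] lemma mem_reg8 : (mem M G v lo).reg 8 = v.j := rfl
@[simp] lemma mem_reg9 : (mem M G v lo).reg 9 = v.x := rfl
@[simp] lemma mem_reg10 : (mem M G v lo).reg 10 = v.y := rfl
@[simp] lemma mem_arr0 : (mem M G v lo).arr 0 = G := rfl

lemma mem_setReg {x : ℕ} (hx : x < 11) (a : ℕ) (v' : Vars)
    (h : Function.update v.toReg x a = v'.toReg) :
    (mem M G v lo).setReg x a = mem M G v' lo := by
  rw [mem, embed_setReg_lt _ _ _ hx, h]; rfl

lemma update_toReg {v v' : Vars} {x a : ℕ} (hx : v'.toReg x = a)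
    (h : ∀ y < 11, y ≠ x → v.toReg y = v'.toReg y) (hx' : x < 11) :
    Function.update v.toReg x a = v'.toReg := by
  funext y
  by_cases hy : y = x
  · subst hy; simp [hx]
  · rw [Function.update_of_ne hy]
    by_cases h11 : y < 11
    · exact h y h11 hy
    · obtain ⟨k, rfl⟩ := Nat.exists_eq_add_of_le (not_lt.1 h11)
      rw [add_comm]; rfl

@[simp] lemma mem_setReg1 (a : ℕ) :
    (mem M G v lo).setReg 1 a = mem M G { v with flag := a } lo :=
  mem_setReg _ _ _ _ (by norm_num) _ _
    (update_toReg rfl (fun y hy hy' => by interval_cases y <;> first | rfl | omega) (by norm_num))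
@[simp] lemma mem_setReg0 (a : ℕ) :
    (mem M G v lo).setReg 0 a = mem M G { v with N := a } lo :=
  mem_setReg _ _ _ _ (by norm_num) _ _
    (update_toReg rfl (fun y hy hy' => by interval_cases y <;> first | rfl | omega) (by norm_num))
@[simp] lemma mem_setReg2 (a : ℕ) :
    (mem M G v lo).setReg 2 a = mem M G { v with c := a } lo :=
  mem_setReg _ _ _ _ (by norm_num) _ _
    (update_toReg rfl (fun y hy hy' => by interval_cases y <;> first | rfl | omega) (by norm_num))
@[simp] lemma mem_setReg3 (a : ℕ) :
    (mem M G v lo).setReg 3 a = mem M G { v with m := a } lo :=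
  mem_setReg _ _ _ _ (by norm_num) _ _
    (update_toReg rfl (fun y hy hy' => by interval_cases y <;> first | rfl | omega) (by norm_num))
@[simp] lemma mem_setReg4 (a : ℕ) :
    (mem M G v lo).setReg 4 a = mem M G { v with L := a } lo :=
  mem_setReg _ _ _ _ (by norm_num) _ _
    (update_toReg rfl (fun y hy hy' => by interval_cases y <;> first | rfl | omega) (by norm_num))
@[simp] lemma mem_setReg5 (a : ℕ) :
    (mem M G v lo).setReg 5 a = mem M G { v with d := a } lo :=
  mem_setReg _ _ _ _ (by norm_num) _ _
    (update_toReg rfl (fun y hy hy' => by interval_cases y <;> first | rfl | omega) (by norm_num))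
@[simp] lemma mem_setReg6 (a : ℕ) :
    (mem M G v lo).setReg 6 a = mem M G { v with neg := a } lo :=
  mem_setReg _ _ _ _ (by norm_num) _ _
    (update_toReg rfl (fun y hy hy' => by interval_cases y <;> first | rfl | omega) (by norm_num))
@[simp] lemma mem_setReg7 (a : ℕ) :
    (mem M G v lo).setReg 7 a = mem M G { v with i := a } lo :=
  mem_setReg _ _ _ _ (by norm_num) _ _
    (update_toReg rfl (fun y hy hy' => by interval_cases y <;> first | rfl | omega) (by norm_num))
@[simp] lemma mem_setReg8 (a : ℕ) :
    (mem M G v lo).setReg 8 a = mem M G { v with j := a } lo :=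
  mem_setReg _ _ _ _ (by norm_num) _ _
    (update_toReg rfl (fun y hy hy' => by interval_cases y <;> first | rfl | omega) (by norm_num))
@[simp] lemma mem_setReg9 (a : ℕ) :
    (mem M G v lo).setReg 9 a = mem M G { v with x := a } lo :=
  mem_setReg _ _ _ _ (by norm_num) _ _
    (update_toReg rfl (fun y hy hy' => by interval_cases y <;> first | rfl | omega) (by norm_num))
@[simp] lemma mem_setReg10 (a : ℕ) :
    (mem M G v lo).setReg 10 a = mem M G { v with y := a } lo :=
  mem_setReg _ _ _ _ (by norm_num) _ _
    (update_toReg rfl (fun y hy hy' => by interval_cases y <;> first | rfl | omega) (by norm_num))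

lemma mem_learner_reg {x : ℕ} (hx : x < M) : (mem M G v lo).reg (x + 11) = lo.reg x :=
  embed_reg _ _ _ hx

lemma mem_learner_setReg {x : ℕ} (hx : x < M) (a : ℕ) :
    (mem M G v lo).setReg (x + 11) a = mem M G v (lo.setReg x a) := embed_setReg _ _ _ hx a

lemma mem_learner_arr {a : ℕ} (ha : a < M) : (mem M G v lo).arr (a + 1) = lo.arr a :=
  embed_arr _ _ _ ha

lemma mem_learner_setArr {a : ℕ} (ha : a < M) (f : ℕ → ℕ) :
    (mem M G v lo).setArr (a + 1) f = mem M G v (lo.setArr a f) := embed_setArr _ _ _ ha f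

end Mem

/-- Only the first `M` registers and arrays of the learner are stored, so clearing those is as good
as starting the learner on an empty memory. -/
lemma mem_congr {M : ℕ} {G : ℕ → ℕ} {v : Vars} {lo lo' : Store}
    (h : ∀ x < M, lo.reg x = lo'.reg x) (h' : ∀ a < M, lo.arr a = lo'.arr a) :
    mem M G v lo = mem M G v lo' := by
  refine store_ext (fun z => ?_) fun b => ?_
  · simp only [mem, embed]
    split_ifs <;> first | rfl | exact h _ (by omega)
  · simp only [mem, embed]
    split_ifs <;> first | rfl | exact h' _ (by omega)

/-! ### Filling in the payoff tables -/

/-- The address of the entry of the adjacency matrix for the vertex `a` of block `i` and the vertex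
`b` of block `m + j`. -/
def addr (N m L i j a b : ℕ) : ℕ := N * (i * L + a) + (m * L + j * L + b)

namespace Expr

/-- The entry of the adjacency matrix for the vertices `a` and `b` of the current blocks. -/
def entry (a b : Expr) : Expr :=
  .get 0 (.add (.mul 0 (.add (.mul 7 (.reg 4)) a))
    (.add (.add (.mul 3 (.reg 4)) (.mul 8 (.reg 4))) b))

lemma eval_entry (a b : Expr) (M : ℕ) (G : ℕ → ℕ) (v : Vars) (lo : Store) :
    (entry a b).eval (mem M G v lo) =
      G (addr v.N v.m v.L v.i v.j (a.eval (mem M G v lo)) (b.eval (mem M G v lo))) := by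
  simp [entry, addr]

/-- The position in the payoff table of the current pair of labels. -/
def cell : Expr := .add (.mul 9 (.reg 4)) (.reg 10)

end Expr

/-- Write the payoffs of the current pair of labels. -/
def putCell (S : ℕ) : Cmd :=
  .seq (put S 1 .cell (.entry (.reg 9) (.reg 10)))
    (.seq (put S 2 .cell (.sub (.const 1) (.entry (.reg 9) (.reg 10)))) (put S 3 .cell (.const 1)))

/-- Write the payoffs of all pairs of labels. -/
def putTable (S : ℕ) : Cmd := countdown S 9 (.reg 4) (countdown S 10 (.reg 4) (putCell S))

/-- The arrays `0, 1, 2` of a memory are overwritten by `f`, `1 - f`, `1` between `k` and `w`. -/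
def fillFrom (f : ℕ → ℕ) (w k : ℕ) (lo : Store) : Store :=
  ((lo.setArr 0 fun z => if k ≤ z ∧ z < w then f z else lo.arr 0 z).setArr 1
    fun z => if k ≤ z ∧ z < w then 1 - f z else lo.arr 1 z).setArr 2
    fun z => if k ≤ z ∧ z < w then 1 else lo.arr 2 z

lemma fillFrom_self (f : ℕ → ℕ) (w : ℕ) (lo : Store) : fillFrom f w w lo = lo := by
  refine store_ext (fun z => rfl) fun b => ?_
  funext z
  simp only [fillFrom, setArr_arr]
  split_ifs <;> first | omega | simp_all

/-- The countdown loops write the tables from the last cell to the first, so the filled part grows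
downwards. -/
lemma fillFrom_succ (f : ℕ → ℕ) {w k : ℕ} (hk : k < w) (lo : Store) :
    fillFrom f w k lo =
      (((fillFrom f w (k + 1) lo).setArr 0 (Function.update ((fillFrom f w (k + 1) lo).arr 0) k
        (f k))).setArr 1 (Function.update ((fillFrom f w (k + 1) lo).arr 1) k (1 - f k))).setArr 2
        (Function.update ((fillFrom f w (k + 1) lo).arr 2) k 1) := by
  refine store_ext (fun z => rfl) fun b => ?_
  funext z
  by_cases hz : z = k
  · subst hz
    simp only [fillFrom, setArr_arr]
    split_ifs <;> simp_all
  · have h' : (k ≤ z ∧ z < w) = (k + 1 ≤ z ∧ z < w) := propext (by omega)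
    simp only [fillFrom, setArr_arr]
    split_ifs <;>
      first | omega | contradiction | simp only [Function.update_apply, hz, if_false, h']

/-- Step bounds for the subroutines of the reduction on graphs with `N` vertices. -/
def cellTime (N : ℕ) : ℕ := 100 * N + 400
def rowTime (N : ℕ) : ℕ := N * (cellTime N + 13) + 7
def tableTime (N : ℕ) : ℕ := N * (rowTime N + 13) + 7

/-- All variables that are used as factors are at most `N`. -/
structure Vars.Bounded (v : Vars) (N : ℕ) : Prop where
  N_eq : v.N = N
  m_le : v.m ≤ N
  L_le : v.L ≤ N
  i_le : v.i ≤ N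
  j_le : v.j ≤ N

/-- The arrays `0, 1, 2` of the learner are the arrays `1, 2, 3` of the machine, and `4 ≤ M` ensures
that they are stored. The values `f`, `1 - f`, `1` encode the payoffs `1` and `-1` for an adjacency
entry `f` equal to `1` and `0`. -/
lemma exec_putCell {M : ℕ} (hM : 4 ≤ M) (G : ℕ → ℕ) (v : Vars) {N : ℕ} (hv : v.Bounded N)
    (lo : Store) (f : ℕ → ℕ)
    (hf : f (v.x * v.L + v.y) = G (addr v.N v.m v.L v.i v.j v.x v.y)) {w : ℕ}
    (hk : v.x * v.L + v.y < w) (hx : v.x ≤ N) :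
    Exec (putCell (11 + M)) (mem M G v (fillFrom f w (v.x * v.L + v.y + 1) lo))
      (mem M G v (fillFrom f w (v.x * v.L + v.y) lo)) (cellTime N) := by
  have he : (Expr.entry (.reg 9) (.reg 10)).Below (11 + M) := by simp [Expr.entry]; omega
  have hc : Expr.cell.Below (11 + M) := by simp [Expr.cell]; omega
  have hcost : ∀ lo, (Expr.entry (.reg 9) (.reg 10)).cost (mem M G v lo) ≤ 16 * N + 70 := by
    intro lo
    have := hv.N_eq; have := hv.m_le; have := hv.i_le; have := hv.j_le
    simp [Expr.entry]; omega
  have hentry : ∀ lo, (Expr.entry (.reg 9) (.reg 10)).eval (mem M G v lo) =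
      f (v.x * v.L + v.y) := by
    intro lo; rw [Expr.eval_entry, hf]; rfl
  have hput : ∀ a < M, ∀ (e : Expr) (val : ℕ) (lo : Store), e.Below (11 + M) →
      (∀ lo, e.eval (mem M G v lo) = val) → (∀ lo, e.cost (mem M G v lo) ≤ 16 * N + 80) →
      Exec (put (11 + M) (a + 1) .cell e) (mem M G v lo)
        (mem M G v (lo.setArr a (Function.update (lo.arr a) (v.x * v.L + v.y) val)))
        (20 * N + 110) := by
    intro a ha e val lo he hval hcost
    have h := exec_put (a := a + 1) hc he (mem_clean M G v lo)
    rw [hval, mem_learner_arr _ _ _ _ ha, mem_learner_setArr _ _ _ _ ha] at h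
    refine h.congr (by simp [Expr.cell]) ?_
    have := hcost lo
    simp [Expr.cell]; omega
  refine ((hput 0 (by omega) _ _ _ he hentry fun lo => (hcost lo).trans (by omega)).seq
    ((hput 1 (by omega) (.sub (.const 1) (.entry (.reg 9) (.reg 10))) (1 - f (v.x * v.L + v.y)) _
      (by simp [he]) (fun lo => by simp [hentry])
        fun lo => by have := hcost lo; simp; omega).seq
    (hput 2 (by omega) (.const 1) 1 _ (by simp) (by simp) (by simp)))).congr ?_ ?_
  · rw [fillFrom_succ f hk]; simp
  · simp only [cellTime]; omega

lemma exec_putTable {M : ℕ} (hM : 4 ≤ M) (G : ℕ → ℕ) (v : Vars) {N : ℕ} (hv : v.Bounded N)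
    (lo : Store) (f : ℕ → ℕ)
    (hf : ∀ x < v.L, ∀ y < v.L, f (x * v.L + y) = G (addr v.N v.m v.L v.i v.j x y))
    (hx : v.x = 0) (hy : v.y = 0) :
    Exec (putTable (11 + M)) (mem M G v lo) (mem M G v (fillFrom f (v.L * v.L) 0 lo))
      (tableTime N) := by
  have hL := hv.L_le
  have key := exec_countdown (S := 11 + M) (x := 9) (e := .reg 4) (s := mem M G v lo)
    (c := countdown (11 + M) 10 (.reg 4) (putCell (11 + M))) (τ := rowTime N)
    (fun x => mem M G { v with x := x } (fillFrom f (v.L * v.L) (x * v.L) lo))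
    (by simp; omega) (by omega) (fun i => mem_clean _ _ _ _) (mem_clean _ _ _ _) (fun i => rfl)
    (by simp [fillFrom_self]) (fun x hxL => by
      simp only [Expr.eval, mem_reg4] at hxL
      have inner := exec_countdown (S := 11 + M) (x := 10) (e := .reg 4)
        (s := mem M G { v with x := x } (fillFrom f (v.L * v.L) ((x + 1) * v.L) lo))
        (c := putCell (11 + M)) (τ := cellTime N)
        (fun y => mem M G { v with x := x, y := y } (fillFrom f (v.L * v.L) (x * v.L + y) lo))
        (by simp; omega) (by omega) (fun i => mem_clean _ _ _ _) (mem_clean _ _ _ _)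
        (fun i => rfl) (by simp [Nat.succ_mul]) (fun y hyL => by
          simp only [Expr.eval, mem_reg4] at hyL
          simp only [mem_setReg10]
          exact exec_putCell hM G { v with x := x, y := y } ⟨hv.1, hv.2, hv.3, hv.4, hv.5⟩ lo f
            (hf x hxL y hyL) (by
              calc x * v.L + y < (x + 1) * v.L := by rw [Nat.succ_mul]; omega
                _ ≤ v.L * v.L := Nat.mul_le_mul_right _ hxL) (by simp; omega))
      simp only [mem_setReg9]
      refine inner.congr (by simp [hy]) ?_
      simp only [Expr.eval, Expr.cost, mem_reg4, rowTime]
      have := Nat.mul_le_mul_right (cellTime N + 13) hL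
      omega)
  refine key.congr (by cases v; simp_all) ?_
  simp only [Expr.eval, Expr.cost, mem_reg4, tableTime]
  have := Nat.mul_le_mul_right (rowTime N + 13) hL
  omega

end RAM

/-! ### Lower bounds along an execution and across a call of the learner -/

namespace RAM

open LocalLearning

lemma wp_mono (t : ℕ) (κ : Config) {f f' : Store → ℝ≥0∞} (h : ∀ s, f s ≤ f' s) :
    wp t κ f ≤ wp t κ f' := by
  rw [wp_eq_expect_steps, wp_eq_expect_steps]
  refine PMF.expect_mono _ fun κ' => ?_
  split_ifs
  · exact h _
  · exact le_rfl

lemma Leads.le {κ κ' : Config} {τ t t' : ℕ} {f : Store → ℝ≥0∞} {a : ℝ≥0∞} (h : Leads κ κ' τ)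
    (ha : a ≤ wp t κ' f) (ht : t + τ ≤ t') : a ≤ wp t' κ f :=
  (ha.trans (h t f)).trans (wp_mono_time ht _ _)

lemma call_le {M B t t' : ℕ} {c : Cmd} (hc : c.Below M) {G : ℕ → ℕ} {v : Vars} {s : Store}
    {K : List Cmd} {f φ : Store → ℝ≥0∞} (h : ∀ s', φ s' ≤ wp t (K, mem M G v s') f)
    (ht : t + B ≤ t') : wp B ([c], s) φ ≤ wp t' (c.shift 11 :: K, mem M G v s) f :=
  ((wp_mono _ _ h).trans (wp_call _ _ _ t K f B [c] (by simpa using hc))).trans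
    (wp_mono_time ht _ _)

end RAM

/-! ### One round of the game, as the machine plays it -/

namespace LocalLearning

open RAM

/-- The Boolean payoff tables that are read off from an adjacency matrix. -/
def arrTable (G : ℕ → ℕ) (N m L : ℕ) (q : Fin m × Fin m) (a b : Fin L) : Bool :=
  decide (G (addr N m L q.1 q.2 a b) = 1)

/-- The tables are stored row by row, so the cell `z` belongs to the labels `z / L` and `z % L`. The
entries of `G` must be bits for the positive and negative parts to be `G` and `1 - G`. -/
lemma showPayoff_crossRound {G : ℕ → ℕ} (hG : ∀ z, G z ≤ 1) (N : ℕ) {m L : ℕ}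
    (q : Fin m × Fin m) (s : Store) :
    showPayoff (crossRound q (arrTable G N m L q)) s =
      fillFrom (fun z => G (addr N m L q.1 q.2 (z / L) (z % L))) (L * L) 0 s := by
  refine store_ext (fun z => rfl) fun b => funext fun z => ?_
  simp only [showPayoff, writeTable, fillFrom, setArr_arr]
  by_cases hz : z < L * L
  · have hz' : 0 ≤ z ∧ z < L * L := ⟨Nat.zero_le _, hz⟩
    have hg := hG (addr N m L q.1 q.2 (z / L) (z % L))
    have h01 : G (addr N m L q.1 q.2 (z / L) (z % L)) = 0 ∨
      G (addr N m L q.1 q.2 (z / L) (z % L)) = 1 := by omega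
    split_ifs <;> first | omega | contradiction | (rcases h01 with h | h <;>
      simp [crossRound, edgePayoff, arrTable, h, hz, hz'])
  · split_ifs <;> first | omega | contradiction | simp [hz]

/-- The expectation of `ψ` at the total payoff in a game with `T` rounds, of which the rounds `g`
remain and `neg` rounds have been lost. -/
noncomputable def value (A : Learner) (B T : ℕ) (ψ : ℚ → ℝ≥0∞) {n L : ℕ} (g : List (Round n L))
    (neg : ℕ) (s : Store) : ℝ≥0∞ :=
  (A.play B g s).expect fun o => o.elim 0 fun p => ψ (T - g.length - 2 * neg + p)

/-- The machine has only natural numbers, so it counts lost rounds. After `r` rounds of which `neg`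
are lost, the payoff is `r - 2 * neg`. -/
lemma value_cons (A : Learner) (B T : ℕ) (ψ : ℚ → ℝ≥0∞) {m L : ℕ} (q : Fin m × Fin m)
    (t : Fin L → Fin L → Bool) (g : List (Round (m + m) L)) (neg : ℕ) (s : Store) :
    value A B T ψ (crossRound q t :: g) neg s =
      wp B ([A.predict], showItems (crossRound q t) s) fun s₁ =>
        if h : s₁.reg 0 < L ∧ s₁.reg 1 < L then
          wp B ([A.update], showPayoff (crossRound q t) s₁) fun s₂ =>
            value A B T ψ g (neg + if t ⟨s₁.reg 0, h.1⟩ ⟨s₁.reg 1, h.2⟩ then 0 else 1) s₂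
        else 0 := by
  rw [value, expect_play_cons _ _ _ _ _ _ rfl]
  congr 1
  funext s₁
  by_cases h : s₁.reg 0 < L ∧ s₁.reg 1 < L
  · rw [dif_pos h, dif_pos h]
    congr 1
    funext s₂
    rw [value]
    congr 1
    funext o
    rcases o with _ | p
    · rfl
    · simp only [Option.map_some, Option.elim_some, List.length_cons]
      congr 1
      simp only [crossRound, edgePayoff]
      split_ifs <;> push_cast <;> ring
  · rw [dif_neg h, dif_neg h]

lemma value_nil (A : Learner) (B T : ℕ) (ψ : ℚ → ℝ≥0∞) (n L : ℕ) (neg : ℕ) (s : Store) :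
    value A B T ψ ([] : List (Round n L)) neg s = ψ (T - 2 * neg) := by
  rw [value, expect_play_nil]; simp

/-! ### Playing the game -/

/-- Play one round. -/
def roundCmd (A : Learner) (S : ℕ) : Cmd :=
  .seq (assign S 11 (.reg 7)) (.seq (assign S 12 (.add (.reg 3) (.reg 8)))
    (.seq (A.predict.shift 11) (.seq (assign S 6 (.add (.reg 6)
      (.sub (.const 1) (.entry (.reg 11) (.reg 12))))) (.seq (putTable S) (A.update.shift 11)))))

/-- Bounds for the number of steps; `B` is a bound for each call of the learner. -/
def roundTime (N B : ℕ) : ℕ := 2 * B + tableTime N + 100 * N + 500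

/-- The three programs use the first `M` registers and arrays. -/
structure Learner.Below (A : Learner) (M : ℕ) : Prop where
  start : A.start.Below M
  predict : A.predict.Below M
  update : A.update.Below M

section Play
variable {A : Learner} {M : ℕ} {G : ℕ → ℕ} {B T : ℕ} {ψ : ℚ → ℝ≥0∞} {f : Store → ℝ≥0∞}

/-- Stated in continuation style, because a round is random: `H` speaks about the rest of the
computation from every memory and every count of losses that the round may leave behind. -/
lemma value_le_round (hA : A.Below M) (hM : 4 ≤ M) (hG : ∀ z, G z ≤ 1) {m : ℕ} {v : Vars} (hm : v.m = m) {N : ℕ} (hv : v.Bounded N)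
    (hx : v.x = 0) (hy : v.y = 0) (q : Fin m × Fin m) (hi : v.i = q.1) (hj : v.j = q.2)
    (g : List (Round (m + m) v.L)) (t : ℕ) (K : List Cmd) (s : Store)
    (H : ∀ neg s', value A B T ψ g neg s' ≤ wp t (K, mem M G { v with neg := neg } s') f) :
    value A B T ψ (crossRound q (arrTable G N m v.L q) :: g) v.neg s ≤
      wp (t + roundTime N B) (roundCmd A (11 + M) :: K, mem M G v s) f := by
  have e1 : ∀ s, Exec (assign (11 + M) 11 (.reg 7)) (mem M G v s)
      (mem M G v (s.setReg 0 v.i)) 5 := fun s => by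
    refine (exec_assign (r := 11) (e := .reg 7) (by simp; omega) (by omega)
      (mem_clean M G v s)).congr ?_ (by simp)
    simpa using mem_learner_setReg M G v s (x := 0) (by omega) v.i
  have e2 : ∀ s, Exec (assign (11 + M) 12 (.add (.reg 3) (.reg 8))) (mem M G v s)
      (mem M G v (s.setReg 1 (v.m + v.j))) 11 := fun s => by
    refine (exec_assign (r := 12) (e := .add (.reg 3) (.reg 8)) (by simp; omega) (by omega)
      (mem_clean M G v s)).congr ?_ (by simp)
    simpa using mem_learner_setReg M G v s (x := 1) (by omega) (v.m + v.j)
  -- The loss is recorded before the update, while the predicted labels are still in the learner's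
  -- registers `0` and `1`, which are the registers `11` and `12` of the machine.
  have e3 : ∀ s : Store, Exec (assign (11 + M) 6 (.add (.reg 6)
      (.sub (.const 1) (.entry (.reg 11) (.reg 12))))) (mem M G v s) (mem M G { v with
        neg := v.neg + (1 - G (addr v.N v.m v.L v.i v.j (s.reg 0) (s.reg 1))) } s)
      (16 * N + 100) := fun s => by
    refine (exec_assign (r := 6) (by simp [Expr.entry]; omega) (by omega)
      (mem_clean M G v s)).congr ?_ ?_
    · have h1 := mem_learner_reg M G v s (x := 0) (by omega)
      have h2 := mem_learner_reg M G v s (x := 1) (by omega)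
      rw [zero_add] at h1
      simp [Expr.eval_entry, h1, h2]
    · have := hv.N_eq; have := hv.m_le; have := hv.i_le; have := hv.j_le
      simp [Expr.entry]; omega
  have e4 : ∀ neg s, Exec (putTable (11 + M)) (mem M G { v with neg := neg } s)
      (mem M G { v with neg := neg } (showPayoff (crossRound q (arrTable G N m v.L q)) s))
      (tableTime N) := fun neg s => by
    rw [showPayoff_crossRound hG]
    refine exec_putTable hM G { v with neg := neg } ⟨hv.1, hv.2, hv.3, hv.4, hv.5⟩ s _
      (fun x hxL y hyL => ?_) hx hy
    change y < v.L at hyL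
    have h1 : (x * v.L + y) / v.L = x := by
      rw [add_comm, Nat.add_mul_div_right _ _ (by omega), Nat.div_eq_of_lt hyL, zero_add]
    have h2 : (x * v.L + y) % v.L = y := by
      rw [add_comm, Nat.add_mul_mod_self_right, Nat.mod_eq_of_lt hyL]
    simp only [h1, h2, hv.N_eq, hm, hi, hj]
  have hitems : showItems (crossRound q (arrTable G N m v.L q)) s =
      (s.setReg 0 v.i).setReg 1 (v.m + v.j) := by
    simp [showItems, crossRound, hi, hj, hm, add_comm m]
  rw [value_cons, hitems]
  refine ((leads_seq K (mem M G v s) _ _).trans ((e1 s _).trans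
    ((leads_seq _ _ _ _).trans ((e2 _ _).trans (leads_seq _ _ _ _))))).le
    (call_le (t := t + B + (tableTime N + 16 * N + 104)) hA.predict (fun s₁ => ?_) le_rfl)
    (by simp only [roundTime]; omega)
  by_cases h : s₁.reg 0 < v.L ∧ s₁.reg 1 < v.L
  · rw [dif_pos h]
    set neg := v.neg + (1 - G (addr v.N v.m v.L v.i v.j (s₁.reg 0) (s₁.reg 1))) with hneg
    have hneg' : (v.neg + if arrTable G N m v.L q ⟨s₁.reg 0, h.1⟩ ⟨s₁.reg 1, h.2⟩ then 0
        else 1) = neg := by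
      have := hG (addr N m v.L q.1 q.2 (s₁.reg 0) (s₁.reg 1))
      simp only [hneg, arrTable, decide_eq_true_eq, hv.N_eq, hm, hi, hj]
      split_ifs <;> omega
    rw [hneg']
    exact ((leads_seq _ _ _ _).trans ((e3 s₁ _).trans ((leads_seq _ _ _ _).trans
      (e4 neg s₁ _)))).le (call_le hA.update (H neg) le_rfl) (by omega)
  · rw [dif_neg h]; exact zero_le

end Play

end LocalLearning

/-! ### Countdown loops with random bodies, one iteration at a time -/

namespace RAM

/-- The loop of a countdown. -/
def loopDown (S x : ℕ) (c : Cmd) : Cmd :=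
  .loop x (.seq (assign S x (.sub (.reg x) (.const 1))) c)

lemma leads_countdown {S x : ℕ} {e : Expr} (he : e.Below S) (hx : x < S) (c : Cmd) (K : List Cmd)
    {s : Store} (hs : ∀ z, S ≤ z → s.reg z = 0) :
    Leads (countdown S x e c :: K, s) (loopDown S x c :: K, s.setReg x (e.eval s))
      (e.cost s + 5) :=
  ((leads_seq _ _ _ _).trans (exec_assign he hx hs _)).mono (by omega)

lemma leads_loopDown_succ {S x : ℕ} (hx : x < S) (c : Cmd) (K : List Cmd)
    {s : Store} (hs : ∀ z, S ≤ z → s.reg z = 0) {k : ℕ} (hk : s.reg x = k + 1) :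
    Leads (loopDown S x c :: K, s) (c :: loopDown S x c :: K, s.setReg x k) 13 := by
  have h := exec_assign (S := S) (r := x) (e := .sub (.reg x) (.const 1)) (s := s)
    (by simp [hx]) hx hs
  simp only [Expr.eval, hk, Nat.add_sub_cancel] at h
  exact ((leads_loop_pos K s _ (by omega)).trans ((leads_seq _ _ _ _).trans (h _))).mono
    (by simp)

lemma leads_loopDown_zero (S : ℕ) {x : ℕ} (c : Cmd) (K : List Cmd) {s : Store}
    (hk : s.reg x = 0) : Leads (loopDown S x c :: K, s) (K, s) 1 := leads_loop_zero _ _ _ hk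

end RAM

/-! ### Rows of rounds and whole games -/

namespace LocalLearning

open RAM

section Play
variable {A : Learner} {M : ℕ} {G : ℕ → ℕ} {B T : ℕ} {ψ : ℚ → ℝ≥0∞} {f : Store → ℝ≥0∞}

lemma value_le_row (hA : A.Below M) (hM : 4 ≤ M) (hG : ∀ z, G z ≤ 1) {v : Vars} {N : ℕ}
    (hv : v.Bounded N) (hx : v.x = 0) (hy : v.y = 0) (i : Fin v.m) (hi : v.i = i)
    (R : List (Round (v.m + v.m) v.L)) (t : ℕ) (K : List Cmd)
    (H : ∀ neg s, value A B T ψ R neg s ≤ wp t (K, mem M G { v with neg := neg, j := 0 } s) f)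
    (j : ℕ) (hj : j ≤ v.m) (neg : ℕ) (s : Store) :
    value A B T ψ (roundsOf (arrTable G N v.m v.L) (rowCells i j hj) ++ R) neg s ≤
      wp (t + (j * (roundTime N B + 13) + 1)) (loopDown (11 + M) 8 (roundCmd A (11 + M)) :: K,
        mem M G { v with neg := neg, j := j } s) f := by
  induction j generalizing neg s with
  | zero => exact (leads_loopDown_zero _ _ _ rfl).le (H neg s) (by omega)
  | succ j ih =>
    refine (leads_loopDown_succ (k := j) (by omega) _ _ (mem_clean _ _ _ _) rfl).le
      (t := t + (j * (roundTime N B + 13) + 1) + roundTime N B) ?_ (by rw [Nat.succ_mul]; omega)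
    rw [mem_setReg8]
    exact value_le_round hA hM hG (v := { v with neg := neg, j := j }) (m := v.m) rfl
      ⟨hv.1, hv.2, hv.3, hv.4, by have := hv.2; simp; omega⟩ hx hy (i, ⟨j, hj⟩) hi rfl _ _ _ s
      (fun neg s => ih (by omega) neg s)

/-- Play the rounds of one row. -/
def rowCmd (A : Learner) (S : ℕ) : Cmd := countdown S 8 (.reg 3) (roundCmd A S)

/-- A bound for the number of steps of the rounds of one row. -/
def playRowTime (N B : ℕ) : ℕ := N * (roundTime N B + 13) + 7

lemma value_le_rows (hA : A.Below M) (hM : 4 ≤ M) (hG : ∀ z, G z ≤ 1) {v : Vars} {N : ℕ}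
    (hv : v.Bounded N) (hx : v.x = 0) (hy : v.y = 0) (hj : v.j = 0) (t : ℕ) (K : List Cmd)
    (H : ∀ (neg : ℕ) s, ψ (T - 2 * neg) ≤ wp t (K, mem M G { v with neg := neg, i := 0 } s) f)
    (i : ℕ) (hi : i ≤ v.m) (neg : ℕ) (s : Store) :
    value A B T ψ (roundsOf (arrTable G N v.m v.L) (cells i hi)) neg s ≤
      wp (t + (i * (playRowTime N B + 13) + 1)) (loopDown (11 + M) 7 (rowCmd A (11 + M)) :: K,
        mem M G { v with neg := neg, i := i } s) f := by
  induction i generalizing neg s with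
  | zero =>
    refine (leads_loopDown_zero _ _ _ rfl).le (t := t) ?_ (by omega)
    exact (value_nil _ _ _ _ _ _ _ _).trans_le (H neg s)
  | succ i ih =>
    have h1 := leads_loopDown_succ (S := 11 + M) (x := 7) (by omega) (rowCmd A (11 + M)) K
      (mem_clean M G { v with neg := neg, i := i + 1 } s) (k := i) rfl
    rw [mem_setReg7] at h1
    have h2 := leads_countdown (S := 11 + M) (x := 8) (e := .reg 3) (by simp; omega) (by omega)
      (roundCmd A (11 + M)) (loopDown (11 + M) 7 (rowCmd A (11 + M)) :: K)
      (mem_clean M G { v with neg := neg, i := i } s)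
    rw [mem_setReg8] at h2
    refine (h1.trans h2).le (t := t + (i * (playRowTime N B + 13) + 1) +
      (v.m * (roundTime N B + 13) + 1)) ?_ ?_
    · rw [cells, roundsOf, List.map_append]
      refine value_le_row hA hM hG (v := { v with i := i })
        ⟨hv.1, hv.2, hv.3, by have := hv.2; simp; omega, hv.5⟩ hx hy ⟨i, hi⟩ rfl _ _ _
        (fun neg s => ?_) v.m le_rfl neg s
      refine (ih (by omega) neg s).trans_eq ?_
      rw [← hj]
    · have := Nat.mul_le_mul_right (roundTime N B + 13) hv.m_le
      rw [Nat.succ_mul]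
      simp only [playRowTime, Expr.cost]
      omega

/-- Set the memory of the learner to zero. -/
def resetCmd (S : ℕ) : ℕ → Cmd
  | 0 => .const S 0
  | k + 1 => .seq (resetCmd S k) (.seq (.const (k + 11) 0) (.clear (k + 1)))

lemma exec_resetCmd (v : Vars) (s : Store) {k : ℕ} (hk : k ≤ M) :
    Exec (resetCmd (11 + M) k) (mem M G v s) (mem M G v
      ⟨fun x => if x < k then 0 else s.reg x, fun a => if a < k then fun _ => 0 else s.arr a⟩)
      (4 * k + 1) := by
  induction k with
  | zero =>
    -- Writing `0` to a scratch register that is already `0` serves as the command that does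
    -- nothing.
    refine Exec.congr (fun K => leads_const K _ (11 + M) 0) (store_ext (fun z => ?_) fun a => ?_)
      (by omega)
    · have := mem_clean M G v s (11 + M) le_rfl
      simp only [setReg_reg]
      split_ifs with h
      · rw [h, mem_clean M G v _ _ le_rfl]
      · rfl
    · rfl
  | succ k ih =>
    refine ((ih (by omega)).seq (Exec.seq (fun K => leads_const K _ (k + 11) 0)
      (fun K => leads_clear K _ (k + 1)))).congr ?_ (by omega)
    rw [mem_learner_setReg _ _ _ _ (by omega), mem_learner_setArr _ _ _ _ (by omega)]
    refine congrArg _ (store_ext (fun z => ?_) fun a => ?_)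
    · simp only [setArr_reg, setReg_reg]
      split_ifs <;> first | rfl | omega
    · simp only [setArr_arr, setReg_arr]
      split_ifs <;> first | rfl | omega

/-- Play the game and set the flag if at most a quarter of the rounds is lost. -/
def playCmd (A : Learner) (M : ℕ) : Cmd :=
  .seq (resetCmd (11 + M) M) (.seq (assign (11 + M) 11 (.add (.reg 3) (.reg 3)))
    (.seq (assign (11 + M) 12 (.reg 4)) (.seq (assign (11 + M) 13 (.mul 3 (.reg 3)))
      (.seq (assign (11 + M) 14 (.reg 0)) (.seq (A.start.shift 11)
        (.seq (countdown (11 + M) 7 (.reg 3) (rowCmd A (11 + M)))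
          (.seq (assign (11 + M) 1 (.sub (.const 1) (.sub (.const 1) (.add (.reg 1) (.sub (.const 1)
            (.sub (.add (.add (.reg 6) (.reg 6)) (.add (.reg 6) (.reg 6))) (.mul 3 (.reg 3))))))))
            (assign (11 + M) 6 (.const 0)))))))))

/-- A bound for the number of steps of a game. -/
def playTime (M N B : ℕ) : ℕ := N * (playRowTime N B + 13) + 20 * N + 4 * M + B + 200

lemma expect_game_le (hA : A.Below M) (hM : 4 ≤ M) (hG : ∀ z, G z ≤ 1) {v : Vars} {N : ℕ}
    (hv : v.Bounded N) (hx : v.x = 0) (hy : v.y = 0) (hj : v.j = 0) (hi : v.i = 0)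
    (hneg : v.neg = 0) (hflag : v.flag ≤ 1) (s : Store) (t : ℕ) (K : List Cmd)
    (H : ∀ (b : Prop) [Decidable b] (x : ℚ) s, (b ↔ (v.m * v.m : ℚ) ≤ 2 * x) →
      ψ x ≤ wp t (K, mem M G { v with flag := if b then 1 else v.flag } s) f) :
    ((A.game B N (crossGame (arrTable G N v.m v.L))).expect fun o => o.elim 0 ψ) ≤
      wp (t + playTime M N B) (playCmd A M :: K, mem M G v s) f := by
  have e1 := exec_resetCmd (M := M) (G := G) v s (k := M) le_rfl
  have hset : ∀ (x : ℕ) (e : Expr) (s : Store), x < 4 → e.Below (11 + M) →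
      Exec (assign (11 + M) (x + 11) e) (mem M G v s)
        (mem M G v (s.setReg x (e.eval (mem M G v s)))) (e.cost (mem M G v s) + 4) :=
    fun x e s hx he => (exec_assign (r := x + 11) he (by omega)
      (mem_clean M G v s)).congr (mem_learner_setReg M G v s (by omega) _) le_rfl
  set s0 : Store := ⟨fun x => if x < M then 0 else s.reg x,
    fun a => if a < M then fun _ => 0 else s.arr a⟩ with hs0
  have e2 := hset 0 (.add (.reg 3) (.reg 3)) s0 (by omega) (by simp; omega)
  have e3 := hset 1 (.reg 4) (s0.setReg 0 (v.m + v.m)) (by omega) (by simp; omega)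
  have e4 := hset 2 (.mul 3 (.reg 3)) ((s0.setReg 0 (v.m + v.m)).setReg 1 v.L) (by omega)
    (by simp; omega)
  have e5 := hset 3 (.reg 0) (((s0.setReg 0 (v.m + v.m)).setReg 1 v.L).setReg 2 (v.m * v.m))
    (by omega) (by simp)
  -- The learner is told `2m` items, `L` labels, `m²` rounds and the size parameter `N`.
  have hstart : mem M G v ((((s0.setReg 0 (v.m + v.m)).setReg 1 v.L).setReg 2 (v.m * v.m)).setReg
      3 v.N) = mem M G v (startStore N (v.m + v.m) v.L (crossGame (arrTable G N v.m v.L)).length) := by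
    rw [length_crossGame]
    refine mem_congr (fun x hx => ?_) fun a ha => ?_
    · simp only [setReg_reg, startStore, hs0, hx, if_true, hv.N_eq]
      split_ifs <;> first | rfl | omega
    · simp only [setReg_arr, startStore, hs0, ha, if_true]
  simp only [Expr.eval, mem_reg3, mem_reg4, mem_reg0] at e2 e3 e4 e5
  rw [hstart] at e5
  rw [expect_game _ _ _ _ _ rfl]
  have hm := hv.m_le
  refine ((leads_seq K (mem M G v s) _ _).trans ((e1 _).trans ((leads_seq _ _ _ _).trans
    ((e2 _).trans ((leads_seq _ _ _ _).trans ((e3 _).trans ((leads_seq _ _ _ _).trans ((e4 _).trans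
    ((leads_seq _ _ _ _).trans ((e5 _).trans (leads_seq _ _ _ _))))))))))).le
    (t := t + B + (N * (playRowTime N B + 13) + 4 * N + 100))
    (call_le (t := t + (N * (playRowTime N B + 13) + 4 * N + 100)) hA.start (fun s₁ => ?_)
      (by omega)) ?_
  swap
  · simp only [Expr.cost, mem_reg3, playTime]
    omega
  have h1 := (leads_seq (K) (mem M G v s₁) (countdown (11 + M) 7 (.reg 3) (rowCmd A (11 + M)))
    (.seq (assign (11 + M) 1 (.sub (.const 1) (.sub (.const 1) (.add (.reg 1) (.sub (.const 1)
            (.sub (.add (.add (.reg 6) (.reg 6)) (.add (.reg 6) (.reg 6))) (.mul 3 (.reg 3))))))))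
            (assign (11 + M) 6 (.const 0)))).trans
    (leads_countdown (S := 11 + M) (x := 7) (e := .reg 3) (by simp; omega) (by omega)
      (rowCmd A (11 + M)) _ (mem_clean M G v s₁))
  rw [mem_setReg7] at h1
  refine h1.le (t := t + (4 * N + 90) + (v.m * (playRowTime N B + 13) + 1)) ?_ ?_
  swap
  · have := Nat.mul_le_mul_right (playRowTime N B + 13) hm
    simp only [Expr.cost]
    omega
  have hval : ((A.play B (crossGame (arrTable G N v.m v.L)) s₁).expect fun o => o.elim 0 ψ) =
      value A B (v.m * v.m) ψ (roundsOf (arrTable G N v.m v.L) (cells v.m le_rfl)) v.neg s₁ := by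
    rw [value]
    change _ = (A.play B (crossGame (arrTable G N v.m v.L)) s₁).expect _
    congr 1
    funext o
    rcases o with _ | p
    · rfl
    · simp only [Option.elim_some]
      have : (roundsOf (arrTable G N v.m v.L) (cells v.m le_rfl)).length = v.m * v.m :=
        length_crossGame _
      rw [this, hneg]; simp
  rw [hval]
  refine (value_le_rows hA hM hG hv hx hy hj (t + (4 * N + 90)) _ (fun neg s => ?_) v.m le_rfl
    v.neg s₁)
  -- The payoff `m² - 2 neg` is at least `m² / 2` exactly if `4 neg ≤ m²`. With truncated
  -- subtraction, `1 - (4 neg - m²)` is the indicator of this, and `1 - (1 - ·)` caps its sum with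
  -- the old flag at `1`.
  have e6 := exec_assign (S := 11 + M) (r := 1) (e := .sub (.const 1) (.sub (.const 1)
    (.add (.reg 1) (.sub (.const 1) (.sub (.add (.add (.reg 6) (.reg 6)) (.add (.reg 6) (.reg 6)))
      (.mul 3 (.reg 3))))))) (by simp; omega) (by omega)
      (mem_clean M G { v with neg := neg, i := 0 } s)
  rw [mem_setReg1] at e6
  simp only [Expr.eval, mem_reg1, mem_reg6, mem_reg3] at e6
  have e7 := exec_assign (S := 11 + M) (r := 6) (e := .const 0) (by simp) (by omega)
      (mem_clean M G { v with neg := neg, i := 0, flag := 1 - (1 - (v.flag +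
        (1 - (neg + neg + (neg + neg) - v.m * v.m)))) } s)
  rw [mem_setReg6] at e7
  refine ((leads_seq _ _ _ _).trans ((e6 _).trans (e7 _))).le (t := t) ?_ ?_
  · refine (H (neg + neg + (neg + neg) ≤ v.m * v.m) _ s ?_).trans_eq ?_
    · rw [← Nat.cast_le (α := ℚ)]
      push_cast
      constructor <;> intro h <;> linarith
    · have : (1 - (1 - (v.flag + (1 - (neg + neg + (neg + neg) - v.m * v.m))))) =
          if neg + neg + (neg + neg) ≤ v.m * v.m then 1 else v.flag := by
        split_ifs <;> omega
      simp only [Expr.eval]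
      rw [this]
      congr 2
      cases v
      simp_all
  · simp only [Expr.cost, mem_reg3]
    omega

end Play

end LocalLearning

namespace LocalLearning

open RAM

/-! ### The reduction -/

/-- The budget of the learner in the game with `m * m` rounds and `L` labels. -/
def budget (p : Polynomial ℕ) (m L : ℕ) : ℕ := p.eval (m + m + L + m * m + 1)

lemma budget_le (p : Polynomial ℕ) {m L N : ℕ} (hm : m ≤ N) (hL : L ≤ N) :
    budget p m L ≤ budget p N N := by
  have hp : Monotone fun x => p.eval x := by
    intro x y hxy
    simp only [Polynomial.eval_eq_sum_range]
    gcongr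
  exact hp (by gcongr)

/-- Divide the number of vertices by `2 m`. -/
def divCmd (S : ℕ) : Cmd :=
  countdown S 5 (.reg 0) (assign S 4 (.add (.reg 4) (.sub (.const 1)
    (.sub (.add (.mul 5 (.add (.reg 3) (.reg 3))) (.add (.reg 3) (.reg 3))) (.reg 0)))))

/-- A bound for the number of steps of the division. -/
def divTime (N : ℕ) : ℕ := N * (4 * N + 100) + 10

/-- The quotient is the number of `d < N` with `(d + 1) * 2m ≤ N`. When the counter is `d`, the
indices from `d` on have been tested, and they contribute `N / (2m) - d`. -/
lemma exec_divCmd (M : ℕ) (G : ℕ → ℕ) (v : Vars) (hL : v.L = 0) (hd : v.d = 0) (hm : 0 < v.m)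
    (s : Store) :
    Exec (divCmd (11 + M)) (mem M G v s) (mem M G { v with L := v.N / (v.m + v.m) } s)
      (divTime v.N) := by
  refine (exec_countdown (S := 11 + M) (x := 5) (e := .reg 0) (s := mem M G v s)
    (τ := 4 * v.N + 87) (fun d => mem M G { v with d := d, L := v.N / (v.m + v.m) - d } s)
    (by simp) (by omega) (fun i => mem_clean _ _ _ _) (mem_clean _ _ _ _) (fun i => rfl) ?_
    (fun d hdN => ?_)).congr ?_ ?_
  · simp only [Expr.eval, mem_reg0, mem_setReg5]
    rw [Nat.sub_eq_zero_of_le (Nat.div_le_self _ _), ← hL]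
  · simp only [Expr.eval, mem_reg0] at hdN
    rw [mem_setReg5]
    refine (exec_assign (r := 4) (by simp; omega) (by omega) (mem_clean M G _ s)).congr ?_ ?_
    · rw [mem_setReg4]
      simp only [Expr.eval, mem_reg0, mem_reg3, mem_reg4, mem_reg5]
      congr 2
      have h := Nat.le_div_iff_mul_le (x := d + 1) (y := v.N) (show 0 < v.m + v.m by omega)
      rw [Nat.succ_mul] at h
      omega
    · simp only [Expr.cost, mem_reg5]
      omega
  · cases v
    simp_all
  · show v.N * (4 * v.N + 100) + 1 + 6 ≤ v.N * (4 * v.N + 100) + 10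
    omega

/-- Play the game with `m = c + 30`. -/
def stepCmd (A : Learner) (M : ℕ) : Cmd :=
  .seq (assign (11 + M) 3 (.add (.reg 2) (.const 30))) (.seq (divCmd (11 + M))
    (.seq (.ite 4 (playCmd A M) (.const (11 + M) 0))
      (.seq (assign (11 + M) 4 (.const 0)) (assign (11 + M) 3 (.const 0)))))

/-- A bound for the number of steps of `stepCmd`. -/
def stepTime (M N B : ℕ) : ℕ := divTime N + playTime M N B + 50

/-- The expectation of `φ` at the final flag, if the games for `c - 1, …, 0` remain. -/
noncomputable def outcome (A : Learner) (p : Polynomial ℕ) (N : ℕ) (G : ℕ → ℕ) (φ : ℕ → ℝ≥0∞) :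
    ℕ → ℕ → ℝ≥0∞
  | 0, b => φ b
  | c + 1, b =>
    if N / (c + 30 + (c + 30)) = 0 then outcome A p N G φ c b
    else (A.game (budget p (c + 30) (N / (c + 30 + (c + 30)))) N
      (crossGame (arrTable G N (c + 30) (N / (c + 30 + (c + 30)))))).expect fun o =>
        o.elim 0 fun x =>
          outcome A p N G φ c (if ((c + 30 : ℕ) * (c + 30 : ℕ) : ℚ) ≤ 2 * x then 1 else b)

/-- The variables between the games. -/
def idle (N b c : ℕ) : Vars := ⟨N, b, c, 0, 0, 0, 0, 0, 0, 0, 0⟩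

section
variable {A : Learner} {M : ℕ} {G : ℕ → ℕ} {f : Store → ℝ≥0∞} {φ : ℕ → ℝ≥0∞}

lemma outcome_le (hA : A.Below M) (hM : 4 ≤ M) (hG : ∀ z, G z ≤ 1) (p : Polynomial ℕ) (N : ℕ)
    (t : ℕ) (K : List Cmd)
    (H : ∀ b s, φ b ≤ wp t (K, mem M G (idle N b 0) s) f) (c b : ℕ) (hb : b ≤ 1) (s : Store) :
    outcome A p N G φ c b ≤ wp (t + (c * (stepTime M N (budget p N N) + 13) + 1))
      (loopDown (11 + M) 2 (stepCmd A M) :: K, mem M G (idle N b c) s) f := by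
  induction c generalizing b s with
  | zero => exact (leads_loopDown_zero _ _ _ rfl).le (H b s) (by omega)
  | succ c ih =>
    set m := c + 30 with hm
    set L := N / (m + m) with hL
    set K' := loopDown (11 + M) 2 (stepCmd A M) :: K
    have h1 := leads_loopDown_succ (S := 11 + M) (x := 2) (by omega) (stepCmd A M) K
      (mem_clean M G (idle N b (c + 1)) s) (k := c) rfl
    rw [mem_setReg2] at h1
    have h2 := exec_assign (r := 3) (e := .add (.reg 2) (.const 30)) (by simp; omega) (by omega)
      (mem_clean M G (idle N b c) s)
    rw [mem_setReg3] at h2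
    have h3 := exec_divCmd M G { idle N b c with m := m } rfl rfl
      (show 0 < m by omega) s
    have tail : ∀ b s, Leads (.seq (assign (11 + M) 4 (.const 0))
        (assign (11 + M) 3 (.const 0)) :: K', mem M G { idle N b c with m := m, L := L } s)
        (K', mem M G (idle N b c) s) 11 := fun b s => by
      have h4 := exec_assign (S := 11 + M) (r := 4) (e := .const 0) (by simp) (by omega)
        (mem_clean M G { idle N b c with m := m, L := L } s)
      rw [mem_setReg4] at h4
      have h5 := exec_assign (S := 11 + M) (r := 3) (e := .const 0) (by simp) (by omega)
        (mem_clean M G { idle N b c with m := m, L := 0 } s)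
      rw [mem_setReg3] at h5
      exact ((leads_seq _ _ _ _).trans ((h4 _).trans (h5 _))).mono (by simp)
    have start : Leads (K', mem M G (idle N b (c + 1)) s)
        (.ite 4 (playCmd A M) (.const (11 + M) 0) :: .seq (assign (11 + M) 4 (.const 0))
        (assign (11 + M) 3 (.const 0)) :: K', mem M G { idle N b c with m := m, L := L } s)
        (divTime N + 27 + 13) :=
      (h1.trans ((leads_seq _ _ _ _).trans ((h2 _).trans ((leads_seq _ _ _ _).trans
        ((h3 _).trans (leads_seq _ _ _ _)))))).mono (by simp [idle]; omega)
    set t' := t + (c * (stepTime M N (budget p N N) + 13) + 1)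
    have htime : t + ((c + 1) * (stepTime M N (budget p N N) + 13) + 1) =
        t' + (stepTime M N (budget p N N) + 13) := by
      rw [Nat.succ_mul]; omega
    rw [htime, outcome]
    -- Without a vertex per block there are no labels and no game. Otherwise `2m ≤ N`, which bounds
    -- the time of the game by that for the budget `budget p N N`.
    by_cases hL0 : L = 0
    · rw [if_pos hL0]
      have h6 := leads_const (.seq (assign (11 + M) 4 (.const 0))
        (assign (11 + M) 3 (.const 0)) :: K') (mem M G { idle N b c with m := m, L := L } s)
        (11 + M) 0
      have h7 : (mem M G { idle N b c with m := m, L := L } s).setReg (11 + M) 0 =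
          mem M G { idle N b c with m := m, L := L } s :=
        store_ext (fun z => by
          rw [setReg_reg]
          split_ifs with h
          · rw [h, mem_clean M G _ _ _ le_rfl]
          · rfl) fun _ => rfl
      rw [h7] at h6
      exact (start.trans ((leads_ite_zero _ _ _ _ hL0).trans (h6.trans (tail b s)))).le
        (ih b hb s) (by simp only [stepTime]; omega)
    · rw [if_neg hL0]
      have hmN : m + m ≤ N := by
        by_contra hlt
        exact hL0 (Nat.div_eq_of_lt (not_le.1 hlt))
      have hLN : L ≤ N := Nat.div_le_self _ _
      have hB := budget_le p (show m ≤ N by omega) hLN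
      refine (start.trans (leads_ite_pos _ _ _ _ hL0)).le
        (t := t' + 11 + playTime M N (budget p m L)) ?_ ?_
      · refine expect_game_le hA hM hG (v := { idle N b c with m := m, L := L })
          ⟨rfl, show m ≤ N by omega, hLN, Nat.zero_le _, Nat.zero_le _⟩ rfl rfl rfl rfl rfl hb s _ _
          (fun d _ x s hd => ?_)
        have hd' : (if ((m : ℕ) * (m : ℕ) : ℚ) ≤ 2 * x then 1 else b) = if d then 1 else b := by
          simp only [hd]
        rw [hd']
        exact (tail _ s).le (ih _ (by split_ifs <;> omega) s) le_rfl
      · simp only [stepTime, playTime, playRowTime, roundTime]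
        have h1 : m * m ≤ N * N := by gcongr <;> omega
        have : N * (N * (2 * budget p m L + tableTime N + 100 * N + 500 + 13) + 7 + 13) ≤
          N * (N * (2 * budget p N N + tableTime N + 100 * N + 500 + 13) + 7 + 13) := by
          gcongr
        omega

/-- The distinguisher. -/
def mainCmd (A : Learner) (M : ℕ) : Cmd :=
  .seq (countdown (11 + M) 2 (.reg 0) (stepCmd A M)) (assign (11 + M) 0 (.reg 1))

/-- A bound for the number of steps of the distinguisher. -/
def mainTime (p : Polynomial ℕ) (M N : ℕ) : ℕ :=
  N * (stepTime M N (budget p N N) + 13) + 20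

lemma outcome_le_main (hA : A.Below M) (hM : 4 ≤ M) (hG : ∀ z, G z ≤ 1) (p : Polynomial ℕ)
    (N : ℕ) (s : Store) :
    outcome A p N G φ N 0 ≤ wp (mainTime p M N) ([mainCmd A M], mem M G (idle N 0 0) s)
      fun s => φ (s.reg 0) := by
  have h1 := leads_countdown (S := 11 + M) (x := 2) (e := .reg 0) (by simp) (by omega)
    (stepCmd A M) [assign (11 + M) 0 (.reg 1)] (mem_clean M G (idle N 0 0) s)
  rw [mem_setReg2] at h1
  refine ((leads_seq _ _ _ _).trans h1).le (outcome_le hA hM hG p N 5 _ (fun b s => ?_) N 0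
    (by omega) s) (by simp [mainTime]; omega)
  have h2 := exec_assign (S := 11 + M) (r := 0) (e := .reg 1) (by simp; omega) (by omega)
    (mem_clean M G (idle N b 0) s)
  rw [mem_setReg0] at h2
  refine (h2 _).le (t := 0) ?_ (by simp)
  rw [wp_nil]
  rfl

end

/-! ### Polynomial bounds -/

/-- The function is a polynomial with natural coefficients. -/
def IsPoly (f : ℕ → ℕ) : Prop := ∃ q : Polynomial ℕ, ∀ N, q.eval N = f N

lemma IsPoly.const (c : ℕ) : IsPoly fun _ => c := ⟨.C c, by simp⟩
lemma IsPoly.id : IsPoly fun N => N := ⟨.X, by simp⟩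
lemma IsPoly.add {f g : ℕ → ℕ} : IsPoly f → IsPoly g → IsPoly fun N => f N + g N :=
  fun ⟨q, hq⟩ ⟨r, hr⟩ => ⟨q + r, by simp [hq, hr]⟩
lemma IsPoly.mul {f g : ℕ → ℕ} : IsPoly f → IsPoly g → IsPoly fun N => f N * g N :=
  fun ⟨q, hq⟩ ⟨r, hr⟩ => ⟨q * r, by simp [hq, hr]⟩
lemma IsPoly.comp {f : ℕ → ℕ} (p : Polynomial ℕ) : IsPoly f → IsPoly fun N => p.eval (f N) :=
  fun ⟨q, hq⟩ => ⟨p.comp q, by simp [hq]⟩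

lemma isPoly_tableTime : IsPoly tableTime := by
  have h1 : IsPoly cellTime := ((IsPoly.const 100).mul .id).add (.const 400)
  have h2 : IsPoly rowTime := (IsPoly.id.mul (h1.add (.const 13))).add (.const 7)
  exact (IsPoly.id.mul (h2.add (.const 13))).add (.const 7)

lemma isPoly_playTime {B : ℕ → ℕ} (hB : IsPoly B) (M : ℕ) :
    IsPoly fun N => playTime M N (B N) := by
  have h1 : IsPoly fun N => roundTime N (B N) :=
    ((((IsPoly.const 2).mul hB).add isPoly_tableTime).add ((IsPoly.const 100).mul .id)).add
      (.const 500)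
  have h2 : IsPoly fun N => playRowTime N (B N) :=
    (IsPoly.id.mul (h1.add (.const 13))).add (.const 7)
  exact ((((IsPoly.id.mul (h2.add (.const 13))).add ((IsPoly.const 20).mul .id)).add
    ((IsPoly.const 4).mul (.const M))).add hB).add (.const 200)

lemma isPoly_mainTime (p : Polynomial ℕ) (M : ℕ) : IsPoly (mainTime p M) := by
  have hB : IsPoly fun N => budget p N N :=
    ((((IsPoly.id.add .id).add .id).add (IsPoly.id.mul .id)).add (.const 1)).comp p
  have hd : IsPoly divTime :=
    (IsPoly.id.mul (((IsPoly.const 4).mul .id).add (.const 100))).add (.const 10)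
  have hs : IsPoly fun N => stepTime M N (budget p N N) :=
    (hd.add (isPoly_playTime hB M)).add (.const 50)
  exact (IsPoly.id.mul (hs.add (.const 13))).add (.const 20)

end LocalLearning

/-! ### From single games to the final flag -/

namespace LocalLearning

open RAM

/-- The probability that the learner gets at least half of the maximal payoff in the game with
`m * m` rounds that is played on an adjacency matrix. -/
noncomputable def winProb (A : Learner) (p : Polynomial ℕ) (N : ℕ) (G : ℕ → ℕ) (m : ℕ) : ℝ≥0∞ :=
  if N / (m + m) = 0 then 0
  else (A.game (budget p m (N / (m + m))) N (crossGame (arrTable G N m (N / (m + m))))).expect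
    fun o => o.elim 0 fun x => if ((m : ℕ) * (m : ℕ) : ℚ) ≤ 2 * x then 1 else 0

section
variable {A : Learner} {p : Polynomial ℕ}

/-- The learner always replies in time. -/
def Learner.Total (A : Learner) (p : Polynomial ℕ) : Prop :=
  ∀ (N n L b : ℕ) (g : List (Round n L)), 1 ≤ L → (∀ r ∈ g, r.HasBits b) →
    none ∉ (A.game (p.eval (n + L + g.length + b)) N g).support

lemma crossGame_hasBits {m L : ℕ} (F : Fin m × Fin m → Fin L → Fin L → Bool) :
    ∀ r ∈ crossGame F, r.HasBits 1 := by
  intro r hr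
  simp only [crossGame, roundsOf, List.mem_map] at hr
  obtain ⟨q, -, rfl⟩ := hr
  exact crossRound_hasBits q _

lemma Learner.Total.none_notMem (hA : A.Total p) (N : ℕ) {m L : ℕ} (hL : L ≠ 0)
    (F : Fin m × Fin m → Fin L → Fin L → Bool) :
    none ∉ (A.game (budget p m L) N (crossGame F)).support := by
  have h := hA N (m + m) L 1 (crossGame F) (by omega) (crossGame_hasBits F)
  rwa [length_crossGame] at h

lemma Learner.Total.expect_le (hA : A.Total p) (N : ℕ) {m L : ℕ} (hL : L ≠ 0)
    (F : Fin m × Fin m → Fin L → Fin L → Bool) {Ψ : Option ℚ → ℝ≥0∞} {c : ℝ≥0∞}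
    (h : ∀ x, c ≤ Ψ (some x)) : c ≤ (A.game (budget p m L) N (crossGame F)).expect Ψ := by
  rw [← PMF.expect_const (A.game (budget p m L) N (crossGame F)) c]
  refine PMF.expect_mono_support _ fun o ho => ?_
  rcases o with _ | x
  · exact absurd ho (hA.none_notMem N hL F)
  · exact h x

variable (N : ℕ) (G : ℕ → ℕ)

lemma one_le_outcome (hA : A.Total p) {φ : ℕ → ℝ≥0∞} (hφ : 1 ≤ φ 1) (c b : ℕ) (hb : 1 ≤ φ b) :
    1 ≤ outcome A p N G φ c b := by
  induction c generalizing b with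
  | zero => exact hb
  | succ c ih =>
    rw [outcome]
    split_ifs with h
    · exact ih b hb
    · refine hA.expect_le N h _ fun x => ?_
      simp only [Option.elim_some]
      split_ifs
      · exact ih 1 hφ
      · exact ih b hb

/-- Union bound over the games: each outcome of a game either is a win, paid for by the summand of
this game, or leaves the flag at `0` for the remaining ones. Totality excludes a loss of probability
through failed calls. -/
lemma one_le_outcome_zero_add (hA : A.Total p) (c : ℕ) :
    1 ≤ outcome A p N G (fun b => if b = 0 then 1 else 0) c 0 +
      ∑ i ∈ Finset.range c, winProb A p N G (i + 30) := by
  induction c with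
  | zero => simp [outcome]
  | succ c ih =>
    rw [outcome, Finset.sum_range_succ]
    split_ifs with h
    · exact ih.trans (by gcongr; exact le_self_add)
    · rw [winProb, if_neg h, add_comm (∑ i ∈ Finset.range c, _), ← add_assoc, ← PMF.expect_add]
      rw [← PMF.expect_const (A.game _ N (crossGame (arrTable G N (c + 30)
        (N / (c + 30 + (c + 30)))))) (∑ i ∈ Finset.range c, winProb A p N G (i + 30)),
        ← PMF.expect_add]
      refine hA.expect_le N h _ fun x => ?_
      simp only [Option.elim_some]
      split_ifs
      · exact le_trans (le_add_self.trans le_self_add) le_rfl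
      · simpa using ih

/-- The flag is never lowered, so one win suffices, whatever the games before and after it bring. -/
lemma winProb_le_outcome (hA : A.Total p) {i c : ℕ} (hi : i < c) (b : ℕ) :
    winProb A p N G (i + 30) ≤ outcome A p N G (fun b => if b = 1 then 1 else 0) c b := by
  have hone : ∀ c, 1 ≤ outcome A p N G (fun b => if b = 1 then 1 else 0) c 1 := fun c =>
    one_le_outcome N G hA (by simp) c 1 (by simp)
  induction c generalizing b with
  | zero => omega
  | succ c ih =>
    rw [outcome]
    by_cases hc : i = c
    · subst hc
      rw [winProb]
      split_ifs with h
      · exact zero_le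
      · refine PMF.expect_mono _ fun o => ?_
        rcases o with _ | x
        · exact le_rfl
        · simp only [Option.elim_some]
          split_ifs
          · exact hone i
          · exact zero_le
    · split_ifs with h
      · exact ih (by omega) b
      · exact hA.expect_le N h _ fun x => ih (by omega) _

end

end LocalLearning

/-! ### The distinguisher as an algorithm on graphs -/

namespace PlantedClique

open RAM LocalLearning

/-- The adjacency matrix of a graph as an array. -/
noncomputable def adjArray {N : ℕ} (G : SimpleGraph (Fin N)) : ℕ → ℕ := (graphStore G).arr 0

lemma adjArray_le_one {N : ℕ} (G : SimpleGraph (Fin N)) (z : ℕ) : adjArray G z ≤ 1 := by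
  simp only [adjArray, graphStore]
  split_ifs <;> simp

lemma graphStore_eq_mem {N : ℕ} (G : SimpleGraph (Fin N)) (M : ℕ) :
    graphStore G = mem M (adjArray G) (idle N 0 0) ⟨fun _ => 0, fun _ _ => 0⟩ := by
  refine store_ext (fun z => ?_) fun a => ?_
  · by_cases hz : z < 11
    · interval_cases z <;> simp [graphStore, idle]
    · simp only [graphStore, mem, embed, hz, if_false, ite_self]
      rw [if_neg (by omega)]
  · simp only [mem, embed, adjArray]
    by_cases ha : a = 0
    · simp [ha]
    · funext i
      simp [graphStore, ha]

lemma outputProb_eq_wp (D : Cmd) (B : ℕ) {N : ℕ} (G : SimpleGraph (Fin N)) (v : ℕ) :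
    outputProb D B G v = wp B ([D], graphStore G) fun s => if s.reg 0 = v then 1 else 0 := by
  rw [outputProb, PMF.apply_eq_expect, PMF.expect_map, ← expect_run]
  congr 1
  funext o
  rcases o with _ | s <;> simp

theorem exists_distinguisher {A : Learner} {p : Polynomial ℕ} (hA : A.Total p) :
    ∃ (D : Cmd) (q : Polynomial ℕ), ∀ (N : ℕ) (G : SimpleGraph (Fin N)),
      none ∉ (D.run (q.eval N) (graphStore G)).support ∧
      1 ≤ outputProb D (q.eval N) G 0 +
        ∑ i ∈ Finset.range N, winProb A p N (adjArray G) (i + 30) ∧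
      ∀ i < N, winProb A p N (adjArray G) (i + 30) ≤ outputProb D (q.eval N) G 1 := by
  obtain ⟨M₁, h₁⟩ := A.start.exists_below
  obtain ⟨M₂, h₂⟩ := A.predict.exists_below
  obtain ⟨M₃, h₃⟩ := A.update.exists_below
  have hM : A.Below (M₁ + M₂ + M₃ + 4) :=
    ⟨h₁.mono (by omega), h₂.mono (by omega), h₃.mono (by omega)⟩
  set M := M₁ + M₂ + M₃ + 4
  obtain ⟨q, hq⟩ := isPoly_mainTime p M
  have key : ∀ (N : ℕ) (G : SimpleGraph (Fin N)) (φ : ℕ → ℝ≥0∞),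
      outcome A p N (adjArray G) φ N 0 ≤ wp (q.eval N) ([mainCmd A M], graphStore G)
        fun s => φ (s.reg 0) := fun N G φ => by
    rw [hq, graphStore_eq_mem G M]
    exact outcome_le_main hM (by omega) (adjArray_le_one G) p N _
  refine ⟨mainCmd A M, q, fun N G => ⟨?_, ?_, fun i hi => ?_⟩⟩
  · refine PMF.notMem_support_of_one_le_expect _ (g := fun o => o.elim 0 fun _ => 1)
      (fun o => by cases o <;> simp) rfl ?_
    rw [expect_run]
    exact (one_le_outcome N _ hA le_rfl N 0 le_rfl).trans (key N G fun _ => 1)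
  · rw [outputProb_eq_wp]
    refine (one_le_outcome_zero_add N (adjArray G) hA N).trans ?_
    gcongr
    exact key N G fun b => if b = 0 then 1 else 0
  · rw [outputProb_eq_wp]
    exact (winProb_le_outcome N (adjArray G) hA hi 0).trans
      (key N G fun b => if b = 1 then 1 else 0)

end PlantedClique

/-! ### Linearity of expected final values -/

namespace RAM

lemma wp_le_const (t : ℕ) (κ : Config) {f : Store → ℝ≥0∞} {c : ℝ≥0∞} (h : ∀ s, f s ≤ c) :
    wp t κ f ≤ c := by
  rw [wp_eq_expect_steps, ← PMF.expect_const (steps t κ) c]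
  refine PMF.expect_mono _ fun κ' => ?_
  split_ifs
  · exact h _
  · exact zero_le

lemma wp_const_mul (t : ℕ) (κ : Config) (c : ℝ≥0∞) (f : Store → ℝ≥0∞) :
    (wp t κ fun s => c * f s) = c * wp t κ f := by
  rw [wp_eq_expect_steps, wp_eq_expect_steps, ← PMF.expect_const_mul]
  congr 1
  funext κ'
  split_ifs <;> simp

lemma wp_finset_sum {ι : Type*} (S : Finset ι) (t : ℕ) (κ : Config) (f : ι → Store → ℝ≥0∞) :
    (wp t κ fun s => ∑ i ∈ S, f i s) = ∑ i ∈ S, wp t κ (f i) := by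
  simp only [wp_eq_expect_steps]
  rw [← PMF.expect_finset_sum]
  congr 1
  funext κ'
  split_ifs <;> simp

end RAM

namespace LocalLearning

open RAM

/-! ### Random payoff tables -/

/-- An exponential weight of a total payoff. -/
noncomputable def weight (x : ℚ) : ℝ≥0∞ := (3 / 2 : ℝ≥0∞) ^ (2 * (x : ℝ))

lemma three_halves_ne_zero : (3 / 2 : ℝ≥0∞) ≠ 0 := by simp
lemma three_halves_ne_top : (3 / 2 : ℝ≥0∞) ≠ ⊤ := ENNReal.div_ne_top (by simp) (by simp)

lemma weight_add (x y : ℚ) : weight (x + y) = weight x * weight y := by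
  rw [weight, weight, weight, ← ENNReal.rpow_add _ _ three_halves_ne_zero three_halves_ne_top]
  congr 1
  push_cast
  ring

lemma weight_zero : weight 0 = 1 := by simp [weight]

/-- The weight is `(9/4)^x`, so this is `9/4 + 4/9`. The base is a square so that a payoff of at
least `T / 2` has weight at least `(3/2)^T`. -/
lemma weight_edge (b : Bool) : weight (edgePayoff b) + weight (edgePayoff !b) = 97 / 36 := by
  have h1 : weight 1 = 9 / 4 := by
    have : weight 1 = (3 / 2 : ℝ≥0∞) ^ (2 : ℕ) := by
      rw [← ENNReal.rpow_natCast]; simp [weight]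
    rw [this, ← ENNReal.toReal_eq_toReal_iff' (by finiteness) (by finiteness)]
    norm_num
  have h2 : weight (-1) = 4 / 9 := by
    have h3 : weight 1 * weight (-1) = 1 := by rw [← weight_add]; simp [weight_zero]
    rw [h1] at h3
    have h4 : weight (-1) = (9 / 4 : ℝ≥0∞)⁻¹ := ENNReal.eq_inv_of_mul_eq_one_left
      (by rw [mul_comm]; exact h3)
    rw [h4, ENNReal.inv_div (by simp) (by simp)]
  have h5 : (9 / 4 + 4 / 9 : ℝ≥0∞) = 97 / 36 := by
    rw [← ENNReal.toReal_eq_toReal_iff' (by finiteness) (by finiteness),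
      ENNReal.toReal_add (by finiteness) (by finiteness)]
    norm_num
  cases b
  · simp only [edgePayoff, Bool.not_false, Bool.false_eq_true, if_false, if_true, h1, h2]
    rw [add_comm, h5]
  · simp only [edgePayoff, Bool.not_true, Bool.false_eq_true, if_false, if_true, h1, h2, h5]

/-- A Boolean payoff table. -/
abbrev Table (L : ℕ) : Type := Fin L → Fin L → Bool

/-- Complementing all entries is a bijection of the tables, and a table and its complement have
average weight `97/72`. -/
lemma sum_weight_table {L : ℕ} (a b : Fin L) :
    ∑ t : Table L, weight (edgePayoff (t a b)) = Fintype.card (Table L) * (97 / 72) := by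
  let e : Table L ≃ Table L :=
    ⟨fun t a b => !t a b, fun t a b => !t a b, fun t => by simp, fun t => by simp⟩
  have h1 : ∑ t : Table L, weight (edgePayoff (t a b)) =
      ∑ t : Table L, weight (edgePayoff (!t a b)) :=
    (Equiv.sum_comp e fun t => weight (edgePayoff (t a b))).symm
  have h2 : 2 * ∑ t : Table L, weight (edgePayoff (t a b)) =
      Fintype.card (Table L) * (97 / 36) := by
    rw [two_mul]
    nth_rewrite 2 [h1]
    rw [← Finset.sum_add_distrib]
    simp only [weight_edge, Finset.sum_const, nsmul_eq_mul, Finset.card_univ]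
  have h3 : (97 / 36 : ℝ≥0∞) = 2 * (97 / 72) := by
    rw [← ENNReal.toReal_eq_toReal_iff' (by finiteness) (by finiteness)]
    norm_num
  rw [h3, ← mul_assoc, mul_comm _ (2 : ℝ≥0∞), mul_assoc] at h2
  exact (ENNReal.mul_right_inj (by simp) (by simp)).1 h2

lemma roundsOf_update {m L : ℕ} (F : Fin m × Fin m → Table L) {l : List (Fin m × Fin m)}
    {q : Fin m × Fin m} (hq : q ∉ l) (t : Table L) :
    roundsOf (Function.update F q t) l = roundsOf F l := by
  refine List.map_congr_left fun q' hq' => ?_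
  rw [Function.update_of_ne]
  rintro rfl
  exact hq hq'

/-- Independence of one coordinate from the others, by the involution that exchanges `F q` with an
extra sample `t`. -/
lemma sum_resample {ι T : Type*} [Fintype ι] [DecidableEq ι] [Fintype T] (q : ι)
    (H : T → (ι → T) → ℝ≥0∞) (hH : ∀ t F t', H t (Function.update F q t') = H t F) :
    Fintype.card T * ∑ F : ι → T, H (F q) F = ∑ t, ∑ F : ι → T, H t F := by
  let e : T × (ι → T) ≃ T × (ι → T) :=
    { toFun := fun x => (x.2 q, Function.update x.2 q x.1)
      invFun := fun x => (x.2 q, Function.update x.2 q x.1)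
      left_inv := fun x => by simp
      right_inv := fun x => by simp }
  rw [← Fintype.sum_prod_type', ← Equiv.sum_comp e, Fintype.sum_prod_type]
  simp only [e, Equiv.coe_fn_mk, hH, Finset.sum_const, nsmul_eq_mul, Finset.card_univ]

/-- Exponential moment, round by round. The labels are chosen before the table of the round is seen,
so each round multiplies the average weight by at most `97/72`. -/
lemma sum_expect_play_le (A : Learner) (B : ℕ) {m L : ℕ} (l : List (Fin m × Fin m))
    (hl : l.Nodup) (s : Store) :
    ∑ F : Fin m × Fin m → Table L, ((A.play B (roundsOf F l) s).expect fun o => o.elim 0 weight) ≤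
      Fintype.card (Fin m × Fin m → Table L) * (97 / 72) ^ l.length := by
  induction l generalizing s with
  | nil => simp [roundsOf, expect_play_nil, weight_zero]
  | cons q l ih =>
    obtain ⟨hq, hl⟩ := List.nodup_cons.1 hl
    set C : ℝ≥0∞ := Fintype.card (Fin m × Fin m → Table L) * (97 / 72) ^ l.length
    let V : (Fin m × Fin m → Table L) → Store → ℝ≥0∞ := fun F s =>
      (A.play B (roundsOf F l) s).expect fun o => o.elim 0 weight
    let s' : Store := (s.setReg 0 (Fin.castAdd m q.1)).setReg 1 (Fin.natAdd m q.2)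
    -- The table `t` of the current round is separated from the tables `F` of the later ones. The
    -- latter do not involve `F q`, because the cell `q` does not recur, so `t` can be resampled.
    let H : Table L → (Fin m × Fin m → Table L) → ℝ≥0∞ := fun t F =>
      wp B ([A.predict], s') fun s₁ =>
        if h : s₁.reg 0 < L ∧ s₁.reg 1 < L then
          weight (edgePayoff (t ⟨s₁.reg 0, h.1⟩ ⟨s₁.reg 1, h.2⟩)) *
            wp B ([A.update], showPayoff (crossRound q t) s₁) (V F)
        else 0
    have h1 : ∀ F : Fin m × Fin m → Table L,
        ((A.play B (roundsOf F (q :: l)) s).expect fun o => o.elim 0 weight) = H (F q) F := by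
      intro F
      rw [roundsOf, List.map_cons, expect_play_cons _ _ _ _ _ _ rfl]
      congr 1
      funext s₁
      by_cases h : s₁.reg 0 < L ∧ s₁.reg 1 < L
      · rw [dif_pos h, dif_pos h, ← wp_const_mul]
        congr 1
        funext s₂
        rw [← PMF.expect_const_mul]
        congr 1
        funext o
        rcases o with _ | x
        · simp
        · simp only [Option.map_some, Option.elim_some, weight_add]
          rfl
      · rw [dif_neg h, dif_neg h]
    have h2 : ∀ t F t', H t (Function.update F q t') = H t F := by
      intro t F t'
      simp only [H, V, roundsOf_update F hq]
    have h3 : ∑ t, ∑ F, H t F ≤ Fintype.card (Table L) * (C * (97 / 72)) := by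
      -- First average over `F` with `t` fixed: the update may depend on `t`, but the induction
      -- hypothesis holds for every memory. Only then average over `t`, with the reply fixed.
      have h4 : ∀ t, ∑ F, H t F ≤ wp B ([A.predict], s') fun s₁ =>
          if h : s₁.reg 0 < L ∧ s₁.reg 1 < L then
            weight (edgePayoff (t ⟨s₁.reg 0, h.1⟩ ⟨s₁.reg 1, h.2⟩)) * C else 0 := by
        intro t
        simp only [H]
        rw [← wp_finset_sum]
        refine wp_mono _ _ fun s₁ => ?_
        by_cases h : s₁.reg 0 < L ∧ s₁.reg 1 < L
        · simp only [dif_pos h]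
          rw [← Finset.mul_sum, ← wp_finset_sum]
          gcongr
          exact wp_le_const _ _ fun s₂ => ih hl s₂
        · simp [dif_neg h]
      refine (Finset.sum_le_sum fun t _ => h4 t).trans ?_
      rw [← wp_finset_sum]
      refine wp_le_const _ _ fun s₁ => ?_
      by_cases h : s₁.reg 0 < L ∧ s₁.reg 1 < L
      · simp only [dif_pos h]
        rw [← Finset.sum_mul, sum_weight_table]
        apply le_of_eq
        ring
      · simp [dif_neg h]
    simp only [h1]
    rw [← sum_resample q H h2] at h3
    have h5 : (Fintype.card (Table L) : ℝ≥0∞) ≠ 0 := by simp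
    have h6 := (ENNReal.mul_le_mul_iff_right h5 (by simp)).1 h3
    refine h6.trans_eq ?_
    rw [List.length_cons, pow_succ, mul_assoc]

lemma weight_lower {T : ℕ} {x : ℚ} (h : (T : ℚ) ≤ 2 * x) : (3 / 2 : ℝ≥0∞) ^ T ≤ weight x := by
  rw [weight, ← ENNReal.rpow_natCast]
  refine ENNReal.rpow_le_rpow_of_exponent_le ?_ (by exact_mod_cast h)
  rw [ENNReal.le_div_iff_mul_le (by simp) (by simp)]
  norm_num

/-- On average over the payoff tables, half of the maximal payoff is exponentially unlikely. -/
lemma sum_win_le (A : Learner) (B N : ℕ) {m L : ℕ} :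
    ∑ F : Fin m × Fin m → Table L, ((A.game B N (crossGame F)).expect fun o => o.elim 0 fun x =>
      if ((m : ℕ) * (m : ℕ) : ℚ) ≤ 2 * x then 1 else 0) ≤
      Fintype.card (Fin m × Fin m → Table L) * (9 / 10) ^ (m * m) := by
  set T := m * m with hT
  have hpow : (3 / 2 : ℝ≥0∞) ^ T ≠ 0 := pow_ne_zero _ three_halves_ne_zero
  have hpow' : (3 / 2 : ℝ≥0∞) ^ T ≠ ⊤ := ENNReal.pow_ne_top three_halves_ne_top
  have h1 : ∑ F : Fin m × Fin m → Table L,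
      ((A.game B N (crossGame F)).expect fun o => o.elim 0 weight) ≤
      Fintype.card (Fin m × Fin m → Table L) * (97 / 72) ^ T := by
    have h2 : ∀ F : Fin m × Fin m → Table L,
        ((A.game B N (crossGame F)).expect fun o => o.elim 0 weight) =
        wp B ([A.start], startStore N (m + m) L T) fun s =>
          (A.play B (crossGame F) s).expect fun o => o.elim 0 weight := fun F => by
      rw [expect_game _ _ _ _ _ rfl, length_crossGame]
    simp only [h2]
    rw [← wp_finset_sum]
    refine wp_le_const _ _ fun s => ?_
    have := sum_expect_play_le A B (L := L) (cells m le_rfl) nodup_cells s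
    rwa [length_cells] at this
  -- Markov's inequality for the weight; the rate is `(97/72) / (3/2) = 97/108`, which is at most
  -- `9/10`.
  have h3 : (3 / 2 : ℝ≥0∞) ^ T * ∑ F : Fin m × Fin m → Table L,
      ((A.game B N (crossGame F)).expect fun o => o.elim 0 fun x =>
        if ((m : ℕ) * (m : ℕ) : ℚ) ≤ 2 * x then 1 else 0) ≤
      (3 / 2 : ℝ≥0∞) ^ T *
        (Fintype.card (Fin m × Fin m → Table L) * (9 / 10) ^ T) := by
    refine le_trans ?_ (h1.trans ?_)
    · rw [Finset.mul_sum]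
      refine Finset.sum_le_sum fun F _ => ?_
      rw [← PMF.expect_const_mul]
      refine PMF.expect_mono _ fun o => ?_
      rcases o with _ | x
      · simp
      · simp only [Option.elim_some]
        split_ifs with h
        · rw [mul_one]
          exact weight_lower (by rw [hT]; push_cast; exact h)
        · simp
    · rw [mul_left_comm, ← mul_pow]
      gcongr
      rw [← ENNReal.toReal_le_toReal (by finiteness) (by finiteness)]
      norm_num
  exact (ENNReal.mul_le_mul_iff_right hpow hpow').1 h3

end LocalLearning

namespace PlantedClique

open RAM LocalLearning

/-! ### The uniform distribution on graphs -/

instance measurableSingletonClass_simpleGraph {V : Type*} [Countable V] :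
    MeasurableSingletonClass (SimpleGraph V) :=
  ⟨fun G => by
    have h : {G} = SimpleGraph.edgeSet ⁻¹' {G.edgeSet} := by ext H; simp
    rw [h]
    exact SimpleGraph.measurable_edgeSet (measurableSet_singleton _)⟩

/-- Edges and non-edges have the same probability, so all graphs have the same mass, and the total
mass `1` determines it. -/
lemma erdosRenyi_singleton {N : ℕ} (G : SimpleGraph (Fin N)) :
    erdosRenyi N {G} = (Fintype.card (SimpleGraph (Fin N)) : ℝ≥0∞)⁻¹ := by
  have hconst : ∀ G : SimpleGraph (Fin N), erdosRenyi N {G} = (1 / 2 : ℝ≥0∞) ^ (N.choose 2) := by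
    intro G
    have hp : ((unitInterval.toNNReal half : NNReal) : ℝ≥0∞) = 1 / 2 := by
      rw [← ENNReal.toReal_eq_toReal_iff' (by simp) (by finiteness)]
      simp [half]
    have hp' : ((unitInterval.toNNReal (unitInterval.symm half) : NNReal) : ℝ≥0∞) = 1 / 2 := by
      rw [← ENNReal.toReal_eq_toReal_iff' (by simp) (by finiteness)]
      simp [half]
      norm_num
    rw [erdosRenyi, SimpleGraph.binomialRandom_singleton, hp, hp', ← pow_add]
    congr 1
    have : G.edgeSet.ncard ≤ (Nat.card (Fin N)).choose 2 := by
      classical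
      rw [← SimpleGraph.coe_edgeFinset, Set.ncard_coe_finset, Nat.card_eq_fintype_card]
      exact SimpleGraph.card_edgeFinset_le_card_choose_two
    rw [Nat.add_sub_cancel' this, Nat.card_fin]
  have hsum : ∑ G : SimpleGraph (Fin N), erdosRenyi N {G} = 1 := by
    have h : IsProbabilityMeasure (erdosRenyi N) := by
      unfold erdosRenyi; infer_instance
    simp
  rw [Finset.sum_congr rfl fun G _ => hconst G, Finset.sum_const, nsmul_eq_mul,
    Finset.card_univ, mul_comm] at hsum
  rw [hconst]
  exact ENNReal.eq_inv_of_mul_eq_one_left hsum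

lemma lintegral_erdosRenyi {N : ℕ} (f : SimpleGraph (Fin N) → ℝ≥0∞) :
    ∫⁻ G, f G ∂erdosRenyi N = (∑ G, f G) / Fintype.card (SimpleGraph (Fin N)) := by
  rw [lintegral_fintype]
  simp only [erdosRenyi_singleton]
  rw [← Finset.sum_mul, div_eq_mul_inv]

instance isProbabilityMeasure_erdosRenyi (N : ℕ) : IsProbabilityMeasure (erdosRenyi N) := by
  unfold erdosRenyi; infer_instance

/-! ### The payoff tables of a graph -/

/-- The payoff tables of the games on a graph. -/
noncomputable def graphTable {N : ℕ} (G : SimpleGraph (Fin N)) (m L : ℕ) (q : Fin m × Fin m) :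
    Table L := arrTable (adjArray G) N m L q

lemma vertex_lt {N m L i a : ℕ} (hN : (m + m) * L ≤ N) (hi : i < m + m) (ha : a < L) :
    i * L + a < N := by
  have h1 : (i + 1) * L ≤ (m + m) * L := Nat.mul_le_mul_right _ hi
  rw [Nat.succ_mul] at h1
  omega

/-- The vertex `a` of block `i`. -/
def vertex {N m L : ℕ} (hN : (m + m) * L ≤ N) (i : Fin (m + m)) (a : Fin L) : Fin N :=
  ⟨i * L + a, vertex_lt hN i.2 a.2⟩

lemma graphTable_apply {N m L : ℕ} (hN : (m + m) * L ≤ N) (G : SimpleGraph (Fin N))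
    (q : Fin m × Fin m) (a b : Fin L) :
    graphTable G m L q a b = true ↔
      G.Adj (vertex hN (Fin.castAdd m q.1) a) (vertex hN (Fin.natAdd m q.2) b) := by
  set u := vertex hN (Fin.castAdd m q.1) a with hu
  set v := vertex hN (Fin.natAdd m q.2) b with hv
  have haddr : addr N m L q.1 q.2 a b = N * u + v := by
    simp [addr, hu, hv, vertex]; ring
  have hlt : N * u.val + v.val < N * N := by
    have h1 : N * (u.val + 1) ≤ N * N := Nat.mul_le_mul_left _ u.2
    have := v.2
    rw [Nat.mul_succ] at h1
    omega
  have h1 : (finProdFinEquiv.symm (⟨N * u.val + v.val, hlt⟩ : Fin (N * N))) = (u, v) := by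
    rw [Equiv.symm_apply_eq]
    ext
    simp [finProdFinEquiv, add_comm]
  rw [graphTable, arrTable, haddr, decide_eq_true_eq]
  simp only [adjArray, graphStore]
  rw [dif_pos ⟨trivial, hlt⟩]
  simp [h1]

/-- The graph whose payoff tables are prescribed and which has no other edges. -/
def tableGraph (N : ℕ) {m L : ℕ} (F : Fin m × Fin m → Table L) : SimpleGraph (Fin N) :=
  SimpleGraph.fromRel fun u v =>
    ∃ (h₁ : u.val / L < m) (h₂ : v.val / L - m < m) (h₃ : 0 < L), m ≤ v.val / L ∧
      F (⟨u.val / L, h₁⟩, ⟨v.val / L - m, h₂⟩) ⟨u.val % L, Nat.mod_lt _ h₃⟩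
        ⟨v.val % L, Nat.mod_lt _ h₃⟩ = true

lemma vertex_div {N m L : ℕ} (hN : (m + m) * L ≤ N) (i : Fin (m + m)) (a : Fin L) :
    (vertex hN i a).val / L = i := by
  have := a.2
  simp only [vertex]
  rw [add_comm, Nat.add_mul_div_right _ _ (by omega), Nat.div_eq_of_lt a.2, zero_add]

lemma vertex_mod {N m L : ℕ} (hN : (m + m) * L ≤ N) (i : Fin (m + m)) (a : Fin L) :
    (vertex hN i a).val % L = a := by
  simp only [vertex]
  rw [add_comm, Nat.add_mul_mod_self_right, Nat.mod_eq_of_lt a.2]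

lemma tableGraph_adj {N m L : ℕ} (hN : (m + m) * L ≤ N) (F : Fin m × Fin m → Table L)
    (q : Fin m × Fin m) (a b : Fin L) :
    (tableGraph N F).Adj (vertex hN (Fin.castAdd m q.1) a) (vertex hN (Fin.natAdd m q.2) b) ↔
      F q a b = true := by
  have hu := vertex_div hN (Fin.castAdd m q.1) a
  have hv := vertex_div hN (Fin.natAdd m q.2) b
  have hu' := vertex_mod hN (Fin.castAdd m q.1) a
  have hv' := vertex_mod hN (Fin.natAdd m q.2) b
  set u := vertex hN (Fin.castAdd m q.1) a
  set v := vertex hN (Fin.natAdd m q.2) b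
  have hq1 := q.1.2
  have hq2 := q.2.2
  have ha := a.2
  simp only [Fin.val_castAdd, Fin.val_natAdd] at hu hv
  have hne : u ≠ v := by
    intro h
    rw [h] at hu
    omega
  simp only [tableGraph, SimpleGraph.fromRel_adj]
  have e : (m + q.2.val) - m = q.2 := by omega
  constructor
  · rintro ⟨-, ⟨h1, h2, h3, h4, h5⟩ | ⟨h1, h2, h3, h4, h5⟩⟩
    · simpa only [hu, hv, hu', hv', e] using h5
    · omega
  · intro h
    refine ⟨hne, Or.inl ⟨by omega, by omega, by omega, by omega, ?_⟩⟩
    simpa only [hu, hv, hu', hv', e] using h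

lemma graphTable_symmDiff {N m L : ℕ} (hN : (m + m) * L ≤ N) (G : SimpleGraph (Fin N))
    (F : Fin m × Fin m → Table L) :
    graphTable (symmDiff G (tableGraph N F)) m L =
      fun q a b => xor (graphTable G m L q a b) (F q a b) := by
  funext q a b
  rw [Bool.eq_iff_iff, graphTable_apply hN, symmDiff_def, SimpleGraph.sup_adj,
    SimpleGraph.sdiff_adj, SimpleGraph.sdiff_adj, tableGraph_adj, ← graphTable_apply hN]
  cases graphTable G m L q a b <;> cases F q a b <;> simp

/-- The payoff tables of a uniformly random graph are uniformly random. -/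
lemma sum_graphTable {N m L : ℕ} (hN : (m + m) * L ≤ N)
    (h : (Fin m × Fin m → Table L) → ℝ≥0∞) :
    Fintype.card (Fin m × Fin m → Table L) * ∑ G : SimpleGraph (Fin N), h (graphTable G m L) =
      Fintype.card (SimpleGraph (Fin N)) * ∑ F, h F := by
  -- Symmetric difference with `tableGraph N F` permutes the graphs and adds `F` to the tables
  -- modulo 2. Averaged over `F`, the tables become uniform for each fixed graph.
  have h1 : ∀ F : Fin m × Fin m → Table L, ∑ G : SimpleGraph (Fin N), h (graphTable G m L) =
      ∑ G : SimpleGraph (Fin N), h fun q a b => xor (graphTable G m L q a b) (F q a b) := by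
    intro F
    let e : SimpleGraph (Fin N) ≃ SimpleGraph (Fin N) :=
      ⟨fun G => symmDiff G (tableGraph N F), fun G => symmDiff G (tableGraph N F),
        fun G => symmDiff_symmDiff_cancel_right _ _, fun G => symmDiff_symmDiff_cancel_right _ _⟩
    rw [← Equiv.sum_comp e]
    simp only [e, Equiv.coe_fn_mk, graphTable_symmDiff hN]
  have h2 : ∀ G : SimpleGraph (Fin N),
      ∑ F : Fin m × Fin m → Table L, h (fun q a b => xor (graphTable G m L q a b) (F q a b)) =
        ∑ F, h F := by
    intro G
    let e : (Fin m × Fin m → Table L) ≃ (Fin m × Fin m → Table L) :=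
      ⟨fun F q a b => xor (graphTable G m L q a b) (F q a b),
        fun F q a b => xor (graphTable G m L q a b) (F q a b),
        fun F => by simp, fun F => by simp⟩
    exact Equiv.sum_comp e h
  calc (Fintype.card (Fin m × Fin m → Table L) : ℝ≥0∞) *
        ∑ G : SimpleGraph (Fin N), h (graphTable G m L)
      = ∑ F : Fin m × Fin m → Table L, ∑ G : SimpleGraph (Fin N), h (graphTable G m L) := by
        rw [Finset.sum_const, nsmul_eq_mul, Finset.card_univ]
    _ = ∑ F : Fin m × Fin m → Table L, ∑ G : SimpleGraph (Fin N),
          h fun q a b => xor (graphTable G m L q a b) (F q a b) :=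
        Finset.sum_congr rfl fun F _ => h1 F
    _ = Fintype.card (SimpleGraph (Fin N)) * ∑ F, h F := by
        rw [Finset.sum_comm, Finset.sum_congr rfl fun G _ => h2 G, Finset.sum_const,
          nsmul_eq_mul, Finset.card_univ]

lemma blocks_le (N m : ℕ) : (m + m) * (N / (m + m)) ≤ N := Nat.mul_div_le _ _

lemma lintegral_winProb_le (A : Learner) (p : Polynomial ℕ) (N m : ℕ) :
    ∫⁻ G, winProb A p N (adjArray G) m ∂erdosRenyi N ≤ (9 / 10) ^ (m * m) := by
  by_cases hL : N / (m + m) = 0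
  · simp [winProb, hL]
  simp only [winProb, if_neg hL]
  rw [lintegral_erdosRenyi]
  set L := N / (m + m)
  set W : (Fin m × Fin m → Table L) → ℝ≥0∞ := fun F =>
    (A.game (budget p m L) N (crossGame F)).expect fun o => o.elim 0 fun x =>
      if ((m : ℕ) * (m : ℕ) : ℚ) ≤ 2 * x then 1 else 0
  change (∑ G : SimpleGraph (Fin N), W (graphTable G m L)) / _ ≤ _
  have h1 := sum_graphTable (blocks_le N m) W
  have h2 := sum_win_le A (budget p m L) N (m := m) (L := L)
  have hF : (Fintype.card (Fin m × Fin m → Table L) : ℝ≥0∞) ≠ 0 := by simp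
  rw [ENNReal.div_le_iff (by simp) (by simp),
    ← ENNReal.mul_le_mul_iff_right hF (by simp), h1]
  refine (mul_le_mul_right h2 _).trans_eq ?_
  ring

/-- Comparison with a geometric series: `(i + 30)² ≥ 60 + i`, and `10 * (9/10)^60` is below `1/5`.
-/
lemma sum_pow_le (N : ℕ) :
    ∑ i ∈ Finset.range N, (9 / 10 : ℝ≥0∞) ^ ((i + 30) * (i + 30)) ≤ 1 / 5 := by
  have h910 : (9 / 10 : ℝ≥0∞) ≤ 1 := by
    rw [ENNReal.div_le_iff (by simp) (by simp)]; norm_num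
  calc ∑ i ∈ Finset.range N, (9 / 10 : ℝ≥0∞) ^ ((i + 30) * (i + 30))
      ≤ ∑ i ∈ Finset.range N, (9 / 10 : ℝ≥0∞) ^ 60 * (9 / 10) ^ i := by
        refine Finset.sum_le_sum fun i _ => ?_
        rw [← pow_add]
        exact pow_le_pow_right_of_le_one' h910 (by nlinarith)
    _ ≤ (9 / 10 : ℝ≥0∞) ^ 60 * ∑' i, (9 / 10 : ℝ≥0∞) ^ i := by
        rw [← Finset.mul_sum]
        gcongr
        exact ENNReal.sum_le_tsum _
    _ ≤ 1 / 5 := by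
        have h1 : (1 - 9 / 10 : ℝ≥0∞) = 1 / 10 := by
          refine ENNReal.sub_eq_of_eq_add (by finiteness) ?_
          rw [← ENNReal.add_div]
          norm_num
          exact (ENNReal.div_self (by simp) (by simp)).symm
        rw [ENNReal.tsum_geometric, h1, ENNReal.inv_div (by simp) (by simp),
          ← ENNReal.toReal_le_toReal (by finiteness) (by finiteness)]
        norm_num

lemma four_fifths_le_random {D : RAM.Cmd} {B N : ℕ} {A : Learner} {p : Polynomial ℕ}
    (h : ∀ G : SimpleGraph (Fin N), 1 ≤ outputProb D B G 0 +
      ∑ i ∈ Finset.range N, winProb A p N (adjArray G) (i + 30)) :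
    4 / 5 ≤ ∫⁻ G, outputProb D B G 0 ∂erdosRenyi N := by
  have h1 : 1 ≤ (∫⁻ G, outputProb D B G 0 ∂erdosRenyi N) + 1 / 5 := by
    calc (1 : ℝ≥0∞) = ∫⁻ _, 1 ∂erdosRenyi N := by simp
      _ ≤ ∫⁻ G, outputProb D B G 0 +
          ∑ i ∈ Finset.range N, winProb A p N (adjArray G) (i + 30) ∂erdosRenyi N :=
        lintegral_mono h
      _ = (∫⁻ G, outputProb D B G 0 ∂erdosRenyi N) +
          ∑ i ∈ Finset.range N, ∫⁻ G, winProb A p N (adjArray G) (i + 30) ∂erdosRenyi N := by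
        rw [lintegral_add_left (measurable_of_finite _),
          lintegral_finsetSum _ fun i _ => measurable_of_finite _]
      _ ≤ _ := by
        gcongr
        exact (Finset.sum_le_sum fun i _ => lintegral_winProb_le A p N (i + 30)).trans
          (sum_pow_le N)
  have h2 : (4 / 5 : ℝ≥0∞) + 1 / 5 = 1 := by
    rw [← ENNReal.add_div]
    norm_num
    exact ENNReal.div_self (by simp) (by simp)
  exact (ENNReal.add_le_add_iff_right (a := 1 / 5) (by finiteness)).1 (h2.trans_le h1)

end PlantedClique

namespace LocalLearning

open RAM

/-! ### From the expected payoff to the probability of a large payoff -/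

lemma abs_le_of_mem_support_play (A : Learner) (B : ℕ) {n L : ℕ} (g : List (Round n L))
    (s : Store) {x : ℚ} (hx : some x ∈ (A.play B g s).support) : |x| ≤ g.length := by
  induction g generalizing s x with
  | nil =>
    rw [Learner.play, PMF.mem_support_pure_iff] at hx
    simp [Option.some.inj hx]
  | cons r g ih =>
    rw [Learner.play, PMF.mem_support_bind_iff] at hx
    obtain ⟨o, -, hx⟩ := hx
    rcases o with _ | s₁
    · simp at hx
    · dsimp only at hx
      split_ifs at hx with h
      · rw [PMF.mem_support_bind_iff] at hx
        obtain ⟨o, -, hx⟩ := hx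
        rcases o with _ | s₂
        · simp at hx
        · dsimp only at hx
          rw [PMF.mem_support_map_iff] at hx
          obtain ⟨o, ho, hx⟩ := hx
          rcases o with _ | y
          · simp at hx
          · simp only [Option.map_some, Option.some.injEq] at hx
            rw [← hx, List.length_cons]
            push_cast
            refine (abs_add_le _ _).trans ?_
            have := r.abs_payoff_le ⟨s₁.reg 0, h.1⟩ ⟨s₁.reg 1, h.2⟩
            have := ih s₂ ho
            linarith
      · simp at hx

lemma abs_le_of_mem_support_game (A : Learner) (B N : ℕ) {n L : ℕ} (g : List (Round n L))
    {x : ℚ} (hx : some x ∈ (A.game B N g).support) : |x| ≤ g.length := by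
  rw [Learner.game, PMF.mem_support_bind_iff] at hx
  obtain ⟨o, -, hx⟩ := hx
  rcases o with _ | s
  · simp at hx
  · exact abs_le_of_mem_support_play A B g s hx

/-- The payoff never exceeds the number of rounds, and it is below half of it unless the game is
won. -/
lemma expectedPayoff_le (A : Learner) (B N : ℕ) {n L : ℕ} (g : List (Round n L)) :
    A.expectedPayoff B N g ≤ g.length / 2 + g.length / 2 *
      ((A.game B N g).expect fun o => o.elim 0 fun x =>
        if (g.length : ℚ) ≤ 2 * x then 1 else 0).toReal := by
  set P := A.game B N g
  set T : ℝ := (g.length : ℝ)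
  let w : Option ℚ → ℝ≥0∞ := fun o => o.elim 0 fun x => if (g.length : ℚ) ≤ 2 * x then 1 else 0
  have hw : ∀ o, w o ≤ 1 := fun o => by
    rcases o with _ | x
    · simp [w]
    · simp only [w, Option.elim_some]; split_ifs <;> simp
  have hbound : ∀ o, |(P o).toReal * ((o.getD 0 : ℚ) : ℝ)| ≤ (P o).toReal * T := by
    intro o
    rw [abs_mul, abs_of_nonneg ENNReal.toReal_nonneg]
    by_cases ho : o ∈ P.support
    · gcongr
      rcases o with _ | x
      · simp [T]
      · have := abs_le_of_mem_support_game A B N g ho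
        simp only [Option.getD_some, T]
        exact_mod_cast this
    · rw [(P.apply_eq_zero_iff o).2 ho]; simp
  have hP : Summable fun o => (P o).toReal := ENNReal.summable_toReal P.tsum_coe_ne_top
  have hP1 : ∑' o, (P o).toReal = 1 := by
    rw [← ENNReal.tsum_toReal_eq fun o => P.apply_ne_top o, P.tsum_coe, ENNReal.toReal_one]
  have hs : Summable fun o => (P o).toReal * ((o.getD 0 : ℚ) : ℝ) :=
    Summable.of_abs (Summable.of_nonneg_of_le (fun _ => abs_nonneg _) hbound (hP.mul_right T))
  have hfin : ∀ o, P o * w o ≠ ⊤ := fun o =>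
    ENNReal.mul_ne_top (P.apply_ne_top o) (ne_top_of_le_ne_top ENNReal.one_ne_top (hw o))
  have hsw : Summable fun o => (P o * w o).toReal := by
    refine ENNReal.summable_toReal (ne_top_of_le_ne_top P.tsum_coe_ne_top ?_)
    refine ENNReal.tsum_le_tsum fun o => ?_
    exact (mul_le_mul_right (hw o) _).trans_eq (mul_one _)
  have hwin : (P.expect w).toReal = ∑' o, (P o * w o).toReal := by
    rw [PMF.expect, ENNReal.tsum_toReal_eq hfin]
  change ∑' o, (P o).toReal * ((o.getD 0 : ℚ) : ℝ) ≤ T / 2 + T / 2 * (P.expect w).toReal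
  rw [hwin, ← tsum_mul_left]
  have h1 : T / 2 = ∑' o, (P o).toReal * (T / 2) := by rw [tsum_mul_right, hP1, one_mul]
  nth_rewrite 1 [h1]
  rw [← (hP.mul_right _).tsum_add (hsw.mul_left _)]
  refine hs.tsum_le_tsum (fun o => ?_) ((hP.mul_right _).add (hsw.mul_left _))
  rw [ENNReal.toReal_mul]
  by_cases ho : o ∈ P.support
  swap
  · rw [(P.apply_eq_zero_iff o).2 ho]; simp
  have hT : 0 ≤ T := by simp [T]
  have hPo : 0 ≤ (P o).toReal := ENNReal.toReal_nonneg
  have hv : ((o.getD 0 : ℚ) : ℝ) ≤ T / 2 + T / 2 * (w o).toReal := by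
    rcases o with _ | x
    · simp [w]; linarith
    · have h2 := (abs_le.1 (abs_le_of_mem_support_game A B N g ho)).2
      have h3 : (x : ℝ) ≤ T := by simp only [T]; exact_mod_cast h2
      simp only [w, Option.elim_some, Option.getD_some]
      split_ifs with h
      · simp; linarith
      · rw [not_le] at h
        have h4 : 2 * (x : ℝ) < T := by simp only [T]; exact_mod_cast h
        simp; linarith
  calc (P o).toReal * ((o.getD 0 : ℚ) : ℝ) ≤ (P o).toReal * (T / 2 + T / 2 * (w o).toReal) := by
        gcongr
    _ = _ := by ring

lemma sum_le_opt {n L : ℕ} (g : List (Round n L)) (l : Fin n → Fin L) :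
    (g.map fun r => (r.payoff (l r.fst) (l r.snd) : ℝ)).sum ≤ opt g :=
  le_ciSup (f := fun l : Fin n → Fin L => (g.map fun r =>
    (r.payoff (l r.fst) (l r.snd) : ℝ)).sum) (Set.finite_range _).bddAbove l

end LocalLearning

namespace PlantedClique

open RAM LocalLearning

/-! ### The best labeling on a graph with a planted clique -/

open Classical in
/-- The number of blocks that contain no vertex of `S`. -/
noncomputable def missed {N m L : ℕ} (hN : (m + m) * L ≤ N) (S : Finset (Fin N)) : ℕ :=
  (Finset.univ.filter fun i : Fin (m + m) => ∀ a : Fin L, vertex hN i a ∉ S).card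

/-- Label every block by one of its vertices in `S`, if there is one. A round between two such
blocks pays `1`. Each missed block takes part in `m` rounds and costs at most `2` in each. -/
lemma le_opt_planted {N m L : ℕ} (hL : 0 < L) (hN : (m + m) * L ≤ N) (G : SimpleGraph (Fin N))
    (S : Finset (Fin N)) :
    (m * m : ℝ) - 2 * m * missed hN S ≤ opt (crossGame (graphTable (G ⊔ cliqueOn S) m L)) := by
  classical
  let l : Fin (m + m) → Fin L := fun i =>
    if h : ∃ a, vertex hN i a ∈ S then h.choose else ⟨0, hL⟩
  let μ : Fin (m + m) → ℝ := fun i => if ∀ a : Fin L, vertex hN i a ∉ S then 1 else 0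
  have hμ : ∀ i, 0 ≤ μ i := fun i => by simp only [μ]; split_ifs <;> simp
  have hl : ∀ i, μ i = 1 ∨ vertex hN i (l i) ∈ S := fun i => by
    by_cases h : ∃ a, vertex hN i a ∈ S
    · right
      simp only [l, dif_pos h]
      exact h.choose_spec
    · left
      push Not at h
      simp [μ, h]
  have hpay : ∀ q : Fin m × Fin m,
      1 - 2 * μ (Fin.castAdd m q.1) - 2 * μ (Fin.natAdd m q.2) ≤
      ((edgePayoff (graphTable (G ⊔ cliqueOn S) m L q (l (Fin.castAdd m q.1))
        (l (Fin.natAdd m q.2))) : ℚ) : ℝ) := by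
    intro q
    have h0 : (-1 : ℝ) ≤ ((edgePayoff (graphTable (G ⊔ cliqueOn S) m L q (l (Fin.castAdd m q.1))
        (l (Fin.natAdd m q.2))) : ℚ) : ℝ) := by
      simp only [edgePayoff]; split_ifs <;> norm_num
    have h1 := hμ (Fin.castAdd m q.1)
    have h2 := hμ (Fin.natAdd m q.2)
    rcases hl (Fin.castAdd m q.1) with h3 | h3
    · linarith
    rcases hl (Fin.natAdd m q.2) with h4 | h4
    · linarith
    have hadj : graphTable (G ⊔ cliqueOn S) m L q (l (Fin.castAdd m q.1))
        (l (Fin.natAdd m q.2)) = true := by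
      rw [graphTable_apply hN, SimpleGraph.sup_adj]
      right
      rw [cliqueOn, SimpleGraph.fromRel_adj]
      refine ⟨fun h => ?_, Or.inl ⟨h3, h4⟩⟩
      have h5 := vertex_div hN (Fin.castAdd m q.1) (l (Fin.castAdd m q.1))
      rw [h, vertex_div hN] at h5
      have := q.1.2
      simp at h5
      omega
    rw [hadj]
    simp only [edgePayoff, if_true, Rat.cast_one]
    linarith
  refine le_trans ?_ (sum_le_opt _ l)
  rw [crossGame, roundsOf, List.map_map]
  have hcells : (cells m le_rfl : List (Fin m × Fin m)).toFinset = Finset.univ := by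
    ext q
    simp [mem_cells]
  have hsum : ((cells m le_rfl).map ((fun r : Round (m + m) L =>
      (r.payoff (l r.fst) (l r.snd) : ℝ)) ∘ fun q =>
        crossRound q (graphTable (G ⊔ cliqueOn S) m L q))).sum =
      ∑ q : Fin m × Fin m, ((edgePayoff (graphTable (G ⊔ cliqueOn S) m L q
        (l (Fin.castAdd m q.1)) (l (Fin.natAdd m q.2))) : ℚ) : ℝ) := by
    rw [← hcells, List.sum_toFinset _ nodup_cells]
    rfl
  rw [hsum]
  refine le_trans ?_ (Finset.sum_le_sum fun q _ => hpay q)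
  have hmiss : (missed hN S : ℝ) = ∑ i : Fin m, μ (Fin.castAdd m i) +
      ∑ j : Fin m, μ (Fin.natAdd m j) := by
    rw [← Fin.sum_univ_add, missed, Finset.card_filter]
    push_cast
    rfl
  rw [hmiss, Fintype.sum_prod_type]
  simp only [Finset.sum_sub_distrib, Finset.sum_const, Finset.card_univ, Fintype.card_fin,
    nsmul_eq_mul, ← Finset.mul_sum]
  apply le_of_eq
  ring

/-- Divide `m² - 2mμ - m²/20 ≤ m²/2 + (m²/2) W` by `m²/2`, where `μ` is the number of missed blocks
and `W` the probability of winning. -/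
lemma nine_tenths_le_winProb {A : Learner} {p : Polynomial ℕ} {N m : ℕ} (hm : 0 < m)
    (hL : N / (m + m) ≠ 0) (G : SimpleGraph (Fin N)) (S : Finset (Fin N))
    (hreg : opt (crossGame (graphTable (G ⊔ cliqueOn S) m (N / (m + m)))) - m * m / 20 ≤
      A.expectedPayoff (budget p m (N / (m + m))) N
        (crossGame (graphTable (G ⊔ cliqueOn S) m (N / (m + m))))) :
    9 / 10 ≤ winProb A p N (adjArray (G ⊔ cliqueOn S)) m +
      4 * missed (blocks_le N m) S / m := by
  have h1 := le_opt_planted (Nat.pos_of_ne_zero hL) (blocks_le N m) G S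
  have h2 := expectedPayoff_le A (budget p m (N / (m + m))) N
    (crossGame (graphTable (G ⊔ cliqueOn S) m (N / (m + m))))
  rw [length_crossGame] at h2
  push_cast at h2
  have h3 : winProb A p N (adjArray (G ⊔ cliqueOn S)) m =
      (A.game (budget p m (N / (m + m))) N
        (crossGame (graphTable (G ⊔ cliqueOn S) m (N / (m + m))))).expect fun o =>
          o.elim 0 fun x => if ((m : ℕ) * (m : ℕ) : ℚ) ≤ 2 * x then 1 else 0 := by
    rw [winProb, if_neg hL]; rfl
  rw [← h3] at h2
  set W := winProb A p N (adjArray (G ⊔ cliqueOn S)) m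
  have hW : W ≤ 1 := by
    rw [h3]
    refine (PMF.expect_mono _ (g' := fun _ => 1) fun o => ?_).trans_eq (PMF.expect_const _ 1)
    rcases o with _ | x
    · simp
    · simp only [Option.elim_some]; split_ifs <;> simp
  have hWt : W ≠ ⊤ := ne_top_of_le_ne_top ENNReal.one_ne_top hW
  have hm0 : (m : ℝ≥0∞) ≠ 0 := by exact_mod_cast hm.ne'
  have hmt : 4 * (missed (blocks_le N m) S : ℝ≥0∞) / m ≠ ⊤ :=
    ENNReal.div_ne_top (by finiteness) hm0
  rw [← ENNReal.toReal_le_toReal (by finiteness) (by finiteness), ENNReal.toReal_add hWt hmt]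
  simp only [ENNReal.toReal_div, ENNReal.toReal_mul, ENNReal.toReal_natCast,
    ENNReal.toReal_ofNat]
  set x := W.toReal
  set μ : ℝ := (missed (blocks_le N m) S : ℝ)
  have hmr : (0 : ℝ) < m := by exact_mod_cast hm
  have h4 : (m * m : ℝ) - 2 * m * μ - m * m / 20 ≤ m * m / 2 + m * m / 2 * x := by linarith
  have h5 : (4 * μ / m : ℝ) = (2 * m * μ) / (m * m / 2) := by field_simp; ring
  have h6 : (0 : ℝ) < m * m / 2 := by positivity
  rw [h5]
  have h7 : 9 / 10 - x ≤ (2 * m * μ) / (m * m / 2) := by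
    rw [le_div_iff₀ h6]; nlinarith
  linarith

/-! ### Averaging over the planted set -/

/-- Double counting: a block of `L` vertices is missed by the `k`-sets in its complement. -/
lemma sum_missed {N m L : ℕ} (hN : (m + m) * L ≤ N) (k : ℕ) :
    ∑ S ∈ (Finset.univ : Finset (Fin N)).powersetCard k, missed hN S =
      (m + m) * (N - L).choose k := by
  classical
  simp only [missed, Finset.card_filter]
  rw [Finset.sum_comm]
  have h : ∀ i : Fin (m + m), ∑ S ∈ (Finset.univ : Finset (Fin N)).powersetCard k,
      (if ∀ a : Fin L, vertex hN i a ∉ S then 1 else 0) = (N - L).choose k := by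
    intro i
    set T : Finset (Fin N) := Finset.univ.image (vertex hN i) with hT
    have hcard : Tᶜ.card = N - L := by
      rw [Finset.card_compl, hT, Finset.card_image_of_injective, Finset.card_univ,
        Fintype.card_fin, Fintype.card_fin]
      intro a b hab
      have := congrArg Fin.val hab
      simp only [vertex] at this
      exact Fin.ext (by omega)
    rw [← hcard, ← Finset.card_powersetCard, ← Finset.card_filter]
    congr 1
    ext S
    simp only [Finset.mem_filter, Finset.mem_powersetCard,
      Finset.subset_iff, Finset.mem_compl, true_and, hT, Finset.mem_image, Finset.mem_univ, not_exists]
    constructor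
    · rintro ⟨h1, h2⟩
      exact ⟨fun u hu a ha => h2 a (ha ▸ hu), h1.2⟩
    · rintro ⟨h1, h2⟩
      exact ⟨⟨fun _ _ => trivial, h2⟩, fun a ha => h1 ha a rfl⟩
  rw [Finset.sum_congr rfl fun i _ => h i]
  simp

lemma lintegral_planted {N k : ℕ} (f : SimpleGraph (Fin N) → ℝ≥0∞) :
    ∫⁻ G, f G ∂planted N k = ((N.choose k : ℝ≥0∞))⁻¹ *
      ∑ S ∈ (Finset.univ : Finset (Fin N)).powersetCard k,
        ∫⁻ G, f (G ⊔ cliqueOn S) ∂erdosRenyi N := by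
  rw [planted, lintegral_smul_measure, lintegral_finsetSum_measure, smul_eq_mul]
  congr 1
  refine Finset.sum_congr rfl fun S _ => ?_
  rw [lintegral_map (measurable_of_finite _) (measurable_of_finite _)]

/-- By `hchoose` at most `2m / 80` blocks are missed on average, which costs `4 * (2m / 80) / m =
1/10` of the `9/10`. -/
lemma four_fifths_le_planted {A : Learner} {p : Polynomial ℕ} {N m k : ℕ} (hm : 0 < m)
    (hL : N / (m + m) ≠ 0) (hk : k ≤ N)
    (hchoose : 80 * (N - N / (m + m)).choose k ≤ N.choose k)
    (hreg : ∀ G : SimpleGraph (Fin N), opt (crossGame (graphTable G m (N / (m + m)))) -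
      m * m / 20 ≤ A.expectedPayoff (budget p m (N / (m + m))) N
        (crossGame (graphTable G m (N / (m + m))))) :
    4 / 5 ≤ ∫⁻ G, winProb A p N (adjArray G) m ∂planted N k := by
  rw [lintegral_planted]
  set F := (Finset.univ : Finset (Fin N)).powersetCard k
  have hcard : (F.card : ℝ≥0∞) = N.choose k := by
    simp [F, Finset.card_powersetCard]
  have hc0 : (N.choose k : ℝ≥0∞) ≠ 0 := by
    exact_mod_cast (Nat.choose_pos hk).ne'
  have hm0 : (m : ℝ≥0∞) ≠ 0 := by exact_mod_cast hm.ne'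
  have h1 : ∀ S ∈ F, (9 / 10 : ℝ≥0∞) ≤
      (∫⁻ G, winProb A p N (adjArray (G ⊔ cliqueOn S)) m ∂erdosRenyi N) +
        4 * missed (blocks_le N m) S / m := by
    intro S _
    calc (9 / 10 : ℝ≥0∞) = ∫⁻ _, 9 / 10 ∂erdosRenyi N := by simp
      _ ≤ ∫⁻ G, winProb A p N (adjArray (G ⊔ cliqueOn S)) m +
          4 * missed (blocks_le N m) S / m ∂erdosRenyi N :=
        lintegral_mono fun G => nine_tenths_le_winProb hm hL G S (hreg _)
      _ = _ := by
        rw [lintegral_add_left (measurable_of_finite _)]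
        simp
  have h2 := Finset.sum_le_sum h1
  rw [Finset.sum_const, nsmul_eq_mul, hcard, Finset.sum_add_distrib] at h2
  set I := ∑ S ∈ F, ∫⁻ G, winProb A p N (adjArray (G ⊔ cliqueOn S)) m ∂erdosRenyi N
  have h3 : ∑ S ∈ F, 4 * (missed (blocks_le N m) S : ℝ≥0∞) / m ≤ N.choose k * (1 / 10) := by
    simp only [div_eq_mul_inv]
    rw [← Finset.sum_mul, ← Finset.mul_sum, ← Nat.cast_sum, sum_missed, ← div_eq_mul_inv,
      ENNReal.div_le_iff hm0 (by simp)]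
    have h4 : ((80 * (N - N / (m + m)).choose k : ℕ) : ℝ≥0∞) ≤ N.choose k := by
      exact_mod_cast hchoose
    push_cast at h4 ⊢
    calc 4 * (((m : ℝ≥0∞) + m) * (N - N / (m + m)).choose k)
        = (80 * ((N - N / (m + m)).choose k : ℝ≥0∞)) * (1 / 10) * m := by
          have : (8 : ℝ≥0∞) = 80 * (1 / 10) := by
            rw [← ENNReal.toReal_eq_toReal_iff' (by finiteness) (by finiteness)]; norm_num
          calc _ = (8 : ℝ≥0∞) * ((N - N / (m + m)).choose k : ℝ≥0∞) * m := by ring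
            _ = _ := by rw [this]; ring
      _ ≤ _ := by
          gcongr
          exact (div_eq_mul_inv _ _).le
  have h5 : (N.choose k : ℝ≥0∞) * (4 / 5) + N.choose k * (1 / 10) ≤
      I + N.choose k * (1 / 10) := by
    refine le_trans (le_of_eq ?_) (h2.trans (by gcongr))
    rw [← mul_add]
    congr 1
    rw [← ENNReal.toReal_eq_toReal_iff' (by finiteness) (by finiteness),
      ENNReal.toReal_add (by finiteness) (by finiteness)]
    norm_num
  have h6 := (ENNReal.add_le_add_iff_right (by finiteness)).1 h5
  rw [mul_comm, ← div_eq_mul_inv, ENNReal.le_div_iff_mul_le (Or.inl hc0) (Or.inl (by simp)),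
    mul_comm]
  exact h6

end PlantedClique

namespace PlantedClique

open RAM LocalLearning

/-! ### The choice of the parameters -/

lemma choose_mul_pow_le {M N : ℕ} (h : M ≤ N) (k : ℕ) :
    M.choose k * N ^ k ≤ N.choose k * M ^ k := by
  induction k with
  | zero => simp
  | succ k ih =>
    have h1 := Nat.choose_succ_right_eq M k
    have h2 := Nat.choose_succ_right_eq N k
    have h3 : (M - k) * N ≤ (N - k) * M := by
      rw [Nat.sub_mul, Nat.sub_mul, Nat.mul_comm M N]
      have : k * M ≤ k * N := Nat.mul_le_mul_left _ h
      omega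
    refine Nat.le_of_mul_le_mul_right (c := k + 1) ?_ (by omega)
    calc M.choose (k + 1) * N ^ (k + 1) * (k + 1)
        = M.choose (k + 1) * (k + 1) * (N ^ k * N) := by ring
      _ = M.choose k * N ^ k * ((M - k) * N) := by rw [h1]; ring
      _ ≤ N.choose k * M ^ k * ((N - k) * M) := Nat.mul_le_mul ih h3
      _ = N.choose (k + 1) * (k + 1) * (M ^ k * M) := by rw [h2]; ring
      _ = N.choose (k + 1) * M ^ (k + 1) * (k + 1) := by ring

/-- The ratio is at most `(1 - L/N)^k ≤ exp (-kL/N) ≤ exp (-5) < 1/80`. -/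
lemma eighty_mul_choose_le {N L k : ℕ} (hN : 0 < N) (hL : L ≤ N) (h : 5 * N ≤ k * L) :
    80 * (N - L).choose k ≤ N.choose k := by
  have h1 := choose_mul_pow_le (Nat.sub_le N L) k
  have hNr : (0 : ℝ) < N := by exact_mod_cast hN
  have h2 : ((N - L).choose k : ℝ) * (N : ℝ) ^ k ≤ N.choose k * ((N : ℝ) - L) ^ k := by
    rw [← Nat.cast_sub hL]; exact_mod_cast h1
  have h3 : ((N : ℝ) - L) ≤ N * Real.exp (-(L / N)) := by
    have := Real.add_one_le_exp (-(L / N : ℝ))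
    calc ((N : ℝ) - L) = N * (-(L / N) + 1) := by field_simp; ring
      _ ≤ _ := by gcongr
  have h0 : (0 : ℝ) ≤ (N : ℝ) - L := by
    rw [sub_nonneg]; exact_mod_cast hL
  have h4 : ((N : ℝ) - L) ^ k ≤ (N : ℝ) ^ k * (1 / 80) := by
    calc ((N : ℝ) - L) ^ k ≤ (N * Real.exp (-(L / N))) ^ k := by gcongr
      _ = (N : ℝ) ^ k * Real.exp (-(k * L / N)) := by
        rw [mul_pow, ← Real.exp_nat_mul]; congr 2; ring
      _ ≤ (N : ℝ) ^ k * Real.exp (-5) := by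
        gcongr
        rw [le_div_iff₀ hNr]
        exact_mod_cast h
      _ ≤ (N : ℝ) ^ k * (1 / 80) := by
        gcongr
        rw [Real.exp_neg, one_div]
        refine inv_anti₀ (by norm_num) ?_
        have h5 : Real.exp 5 = Real.exp 1 ^ 5 := by rw [← Real.exp_nat_mul]; norm_num
        have h6 : (2.7 : ℝ) ≤ Real.exp 1 := by
          have := Real.exp_one_gt_d9; linarith
        rw [h5]
        calc (80 : ℝ) ≤ 2.7 ^ 5 := by norm_num
          _ ≤ _ := by gcongr
  have h7 : ((N - L).choose k : ℝ) * (N : ℝ) ^ k ≤ (N.choose k * (1 / 80)) * (N : ℝ) ^ k := by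
    refine h2.trans ?_
    rw [mul_assoc, mul_comm (1 / 80 : ℝ)]
    gcongr
  have h8 := le_of_mul_le_mul_right h7 (by positivity)
  have h9 : (80 : ℝ) * (N - L).choose k ≤ N.choose k := by linarith
  exact_mod_cast h9

/-- The regret is at most a twentieth of the number of rounds. -/
lemma regret_le {N m L : ℕ} {C ε δ K : ℝ} (hN : 0 < N) (hε : 0 < ε) (hδ : 0 ≤ δ)
    (hK : K = (N : ℝ) ^ (1 / 2 - ε)) (hm : 0 < m) (hKm : K ≤ 80 * m) (hL : 0 < L)
    (hLm : L * (m + m) ≤ N) (hNL : N ≤ 4 * (m * L))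
    (hC : 3200 * C ^ 2 ≤ N) (hC' : 5120000 * C ^ 2 ≤ (N : ℝ) ^ δ) :
    C * Real.sqrt ((m + m : ℕ) * (L : ℝ) ^ ((1 - δ) * (1 / (1 / 2 + ε)) - 1) * (m * m : ℕ)) ≤
      m * m / 20 := by
  have hNr : (0 : ℝ) < N := by exact_mod_cast hN
  have hmr : (0 : ℝ) < m := by exact_mod_cast hm
  have hLr : (1 : ℝ) ≤ L := by exact_mod_cast hL
  have hL0 : (0 : ℝ) < L := by linarith
  set γ := (1 - δ) * (1 / (1 / 2 + ε)) with hγ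
  have hε' : 0 < 1 / 2 + ε := by linarith
  have hNL' : (N : ℝ) ≤ 4 * (m * L) := by exact_mod_cast hNL
  have hLm' : (L : ℝ) * (m + m) ≤ N := by exact_mod_cast hLm
  -- Since `N ≤ 4mL`, this gives `800 C² L^(γ-1) ≤ m`, which is the claim after squaring. If `δ >
  -- 1`, then `γ ≤ 0` and `L^γ ≤ 1`.
  have key : 3200 * C ^ 2 * (L : ℝ) ^ γ ≤ N := by
    rcases le_total δ 1 with h1 | h1
    · have hγ0 : 0 ≤ γ := mul_nonneg (by linarith) (by positivity)
      have hγ2 : γ ≤ 2 := by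
        rw [hγ, mul_one_div, div_le_iff₀ hε']; linarith
      -- From `2mL ≤ N = N^(1/2+ε) K` and `K ≤ 80m`. Raised to the power `γ ≤ 2`, the factor `40`
      -- becomes at most `1600`, and `3200 * 1600 = 5120000`.
      have hL40 : (L : ℝ) ≤ 40 * (N : ℝ) ^ (1 / 2 + ε) := by
        have h2 : (N : ℝ) = (N : ℝ) ^ (1 / 2 + ε) * K := by
          rw [hK, ← Real.rpow_add hNr]; ring_nf; simp
        have h3 : (L : ℝ) * (2 * m) ≤ 40 * (N : ℝ) ^ (1 / 2 + ε) * (2 * m) := by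
          calc (L : ℝ) * (2 * m) = L * (m + m) := by ring
            _ ≤ N := hLm'
            _ = (N : ℝ) ^ (1 / 2 + ε) * K := h2
            _ ≤ (N : ℝ) ^ (1 / 2 + ε) * (80 * m) := by gcongr
            _ = _ := by ring
        exact le_of_mul_le_mul_right h3 (by positivity)
      have h4 : (L : ℝ) ^ γ ≤ 1600 * (N : ℝ) ^ (1 - δ) := by
        calc (L : ℝ) ^ γ ≤ (40 * (N : ℝ) ^ (1 / 2 + ε)) ^ γ :=
              Real.rpow_le_rpow hL0.le hL40 hγ0
          _ = 40 ^ γ * (N : ℝ) ^ (1 - δ) := by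
              rw [Real.mul_rpow (by norm_num) (by positivity), ← Real.rpow_mul hNr.le]
              congr 2
              rw [hγ]; field_simp
          _ ≤ 1600 * (N : ℝ) ^ (1 - δ) := by
              gcongr
              calc (40 : ℝ) ^ γ ≤ 40 ^ (2 : ℝ) :=
                    Real.rpow_le_rpow_of_exponent_le (by norm_num) hγ2
                _ = 1600 := by norm_num
      calc 3200 * C ^ 2 * (L : ℝ) ^ γ ≤ 3200 * C ^ 2 * (1600 * (N : ℝ) ^ (1 - δ)) := by gcongr
        _ = 5120000 * C ^ 2 * (N : ℝ) ^ (1 - δ) := by ring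
        _ ≤ (N : ℝ) ^ δ * (N : ℝ) ^ (1 - δ) := by gcongr
        _ = N := by rw [← Real.rpow_add hNr]; simp
    · have hγ0 : γ ≤ 0 := mul_nonpos_of_nonpos_of_nonneg (by linarith) (by positivity)
      have h2 : (L : ℝ) ^ γ ≤ 1 := Real.rpow_le_one_of_one_le_of_nonpos hLr hγ0
      calc 3200 * C ^ 2 * (L : ℝ) ^ γ ≤ 3200 * C ^ 2 * 1 := by gcongr
        _ ≤ (N : ℝ) := by linarith
  have h5 : (L : ℝ) ^ (γ - 1) * L = (L : ℝ) ^ γ := by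
    rw [Real.rpow_sub_one hL0.ne']; field_simp
  have h6 : 800 * C ^ 2 * (L : ℝ) ^ (γ - 1) ≤ m := by
    have : 800 * C ^ 2 * (L : ℝ) ^ (γ - 1) * L ≤ m * L := by
      rw [mul_assoc, h5]; linarith
    exact le_of_mul_le_mul_right this hL0
  have h7 : (0 : ℝ) ≤ (L : ℝ) ^ (γ - 1) := by positivity
  refine (le_abs_self _).trans (abs_le_of_sq_le_sq ?_ (by positivity))
  rw [mul_pow, Real.sq_sqrt (by positivity)]
  push_cast
  calc C ^ 2 * (((m : ℝ) + m) * (L : ℝ) ^ (γ - 1) * (m * m))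
      = 800 * C ^ 2 * (L : ℝ) ^ (γ - 1) * ((m : ℝ) ^ 3 / 400) := by ring
    _ ≤ m * ((m : ℝ) ^ 3 / 400) := by gcongr
    _ = ((m : ℝ) * m / 20) ^ 2 := by ring

end PlantedClique

/-! ### The theorem -/

open PlantedClique LocalLearning in
theorem theorem1 (ε δ β : ℕ → ℝ) (C : ℝ)
    (hε : ∃ ε₀ : ℝ, 0 < ε₀ ∧ ∀ᶠ N : ℕ in atTop, ε₀ ≤ ε N)
    (hk : Tendsto (fun N : ℕ => (N : ℝ) ^ (1 / 2 - ε N)) atTop atTop)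
    (hδ : Tendsto (fun N : ℕ => δ N * Real.log N) atTop atTop)
    (hβ : ∀ N : ℕ, β N = (1 - δ N) * (1 / (1 / 2 + ε N)) - 1)
    (hA : LocalLearning.RegretAchievable fun N n L T =>
      C * Real.sqrt (n * (L : ℝ) ^ β N * T)) :
    PlantedClique.PolyTimeDistinguishable
      (fun N => PlantedClique.erdosRenyi N)
      (fun N => PlantedClique.planted N ⌊(N : ℝ) ^ (1 / 2 - ε N)⌋₊) := by
  obtain ⟨A, p, htotal, hreg⟩ := hA
  obtain ⟨D, q, hD⟩ := exists_distinguisher htotal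
  refine ⟨D, q, fun N G => (hD N G).1, ?_⟩
  obtain ⟨ε₀, hε₀, hε⟩ := hε
  filter_upwards [hreg, hε, hk.eventually_ge_atTop 1000,
    hδ.eventually_ge_atTop (max 0 (Real.log (5120000 * C ^ 2 + 1))),
    tendsto_natCast_atTop_atTop.eventually_ge_atTop (3200 * C ^ 2), eventually_ge_atTop 2]
    with N hreg hεN hkN hδN hCN hN2
  refine ⟨four_fifths_le_random fun G => (hD N G).2.1, ?_⟩
  have hNr : (1 : ℝ) < N := by exact_mod_cast hN2
  have hN0 : (0 : ℝ) < N := by linarith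
  have hlog : 0 < Real.log N := Real.log_pos hNr
  have hδ0 : 0 ≤ δ N := by
    by_contra h
    have := mul_neg_of_neg_of_pos (not_le.1 h) hlog
    linarith [le_max_left 0 (Real.log (5120000 * C ^ 2 + 1))]
  have hNδ : 5120000 * C ^ 2 ≤ (N : ℝ) ^ δ N := by
    rw [Real.rpow_def_of_pos hN0, mul_comm (Real.log _)]
    calc 5120000 * C ^ 2 ≤ 5120000 * C ^ 2 + 1 := by linarith
      _ = Real.exp (Real.log (5120000 * C ^ 2 + 1)) := (Real.exp_log (by positivity)).symm
      _ ≤ _ := Real.exp_le_exp.2 ((le_max_right _ _).trans hδN)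
  set K : ℝ := (N : ℝ) ^ (1 / 2 - ε N) with hK
  set k := ⌊K⌋₊ with hkdef
  -- This choice exists only in the analysis; the distinguisher tries all `m`. It yields `5N ≤ 20mL
  -- ≤ kL`, and `K ≥ 1000` makes `m` large enough to be among the values tried.
  set m := k / 20 with hmdef
  set L := N / (m + m) with hLdef
  have hkK : (k : ℝ) ≤ K := Nat.floor_le (by linarith)
  have hkK' : K < k + 1 := Nat.lt_floor_add_one K
  have hk999 : 999 < k := by
    have : (999 : ℝ) < k := by linarith
    exact_mod_cast this
  -- From `ε > 0`. Thus the number `m²` of rounds is at most `N`, as the regret guarantee demands.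
  have hKsq : K * K ≤ N := by
    rw [hK, ← Real.rpow_add hN0]
    calc (N : ℝ) ^ (1 / 2 - ε N + (1 / 2 - ε N)) ≤ (N : ℝ) ^ (1 : ℝ) :=
          Real.rpow_le_rpow_of_exponent_le hNr.le (by linarith)
      _ = N := Real.rpow_one _
  have hkk : k * k ≤ N := by
    have : (k : ℝ) * k ≤ N := by
      refine le_trans ?_ hKsq
      gcongr
    exact_mod_cast this
  have hkN : k ≤ N := by nlinarith
  have hmk : 20 * m ≤ k := Nat.mul_div_le k 20
  have hkm : k < 20 * m + 20 := by omega
  have hm30 : 30 ≤ m := by omega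
  have hmm : m * m ≤ N := by nlinarith
  have hmN : m + m ≤ N := by omega
  have hL1 : 0 < L := Nat.div_pos hmN (by omega)
  have hLN : L ≤ N := Nat.div_le_self _ _
  have hLm : L * (m + m) ≤ N := Nat.div_mul_le_self _ _
  -- Rounding down loses at most a factor `2`: `N < 2m (L + 1) ≤ 4mL`.
  have hNL : N ≤ 4 * (m * L) := by
    have := Nat.lt_mul_div_succ N (show 0 < m + m by omega)
    rw [← hLdef] at this
    nlinarith
  have h5 : 5 * N ≤ k * L := by nlinarith
  have hgame : ∀ G : SimpleGraph (Fin N), opt (crossGame (graphTable G m L)) - m * m / 20 ≤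
      A.expectedPayoff (budget p m L) N (crossGame (graphTable G m L)) := by
    intro G
    have h1 := hreg (m + m) L 1 (crossGame (graphTable G m L)) (by omega) hmN hL1 hLN
      (by rw [length_crossGame]; exact hmm) (crossGame_hasBits _)
    rw [length_crossGame, hβ N] at h1
    have h2 := regret_le (C := C) (δ := δ N) (by omega) (hε₀.trans_le hεN) hδ0 hK
      (show 0 < m by omega) (by
        have : (k : ℝ) + 1 ≤ 80 * m := by
          have : k + 1 ≤ 80 * m := by omega
          exact_mod_cast this
        linarith) hL1 hLm hNL hCN hNδ
    have h3 : A.expectedPayoff (p.eval (m + m + L + m * m + 1)) N (crossGame (graphTable G m L)) =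
        A.expectedPayoff (budget p m L) N (crossGame (graphTable G m L)) := rfl
    linarith
  refine (four_fifths_le_planted (A := A) (p := p) (by omega) hL1.ne' hkN
    (eighty_mul_choose_le (by omega) hLN h5) hgame).trans (lintegral_mono fun G => ?_)
  have := (hD N G).2.2 (m - 30) (by omega)
  rwa [Nat.sub_add_cancel hm30] at this
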